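/- Let a source transmit to a destination through a reconfigurable intelligent surface with $N$ reflection units. The channels $h_i$ (source to unit $i$) and $g_i$ (unit $i$ to destination), $1\le i\le N$, are independent complex random variables whose magnitudes are Rayleigh distributed with scale parameter $1$, and each unit applies the optimal phase shift with unit gain, so that the end-to-end channel is $A=\sum_{i=1}^N|h_i||g_i|$. The ergodic capacity at transmission SNR $\rho_t>0$ is $C(N,\rho_t)=\mathbb E[\log_2(1+\rho_tA^2)]$. Put $$k_1=\frac{N\pi}{2},\quad k_2=4N\Bigl(1-\frac{\pi^2}{16}\Bigr),\quad a=\frac{k_1^2}{k_2}-1,\quad b=\frac{k_2}{k_1},\quad f_A(x)=\frac{x^ae^{-x/b}}{b^{a+1}\Gamma(a+1)}\ (x>0),$$ where $f_A$ is the closed-form approximation of the density of $A$, and let $C_f(N,\rho_t)=\int_0^\infty\log_2(1+\rho_ty^2)f_A(y)\,dy$ be the capacity computed from it. Let $(x)_n$ be the Pochhammer symbol, $\psi=\Gamma'/\Gamma$ the digamma function, and $$C_{\rho,N}=\frac{1}{\ln(2)\,(a-1)_2\,b^2\rho_t}+\frac{a^2-a}{(a-1)_2}\log_2(b^2\rho_t)+\frac{2(a^2-a)}{\ln(2)\,(a-1)_2}\psi(a+3),$$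 $$\mathcal B_1=\frac{\pi\csc(a\pi/2)}{\ln(2)(2+a)b^{a+2}\Gamma(a+1)\rho_t^{a/2+1}},\qquad \mathcal B_2=\frac{\pi\sec(a\pi/2)}{(a+1)b^{a+1}\ln(2)\Gamma(a+1)\rho_t^{(a+1)/2}}.$$ For all $N\ge1$ and $\rho_t>0$ all these expressions are well defined: $\sin(a\pi/2)$, $\cos(a\pi/2)$ and $(a-1)_2$ are non-zero, and the expectation and the integral converge absolutely. As $N\to\infty$, $1/\Gamma(a+1)\to0$, and for every $\rho_0>0$, uniformly in $\rho_t\ge\rho_0$ (in particular as $N\to\infty$ and $\rho_t\to\infty$ jointly): 1. $\mathcal B_1\to0$ and $\mathcal B_2\to0$; hence the high-SNR approximation $C_\rho=C_{\rho,N}+\mathcal B_1+\mathcal B_2$ satisfies $C_\rho-C_{\rho,N}\to0$; 2. $C_{\rho,N}$ approximates the ergodic capacity: $C(N,\rho_t)-C_{\rho,N}\to0$ and $C_f(N,\rho_t)-C_{\rho,N}\to0$. -/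

import Mathlib

open Filter Topology MeasureTheory ProbabilityTheory
open scoped Real

namespace RIS

noncomputable section

/-! ### Special functions -/

/-- The cosecant. -/
def csc (x : ℝ) : ℝ := 1 / Real.sin x

/-- The secant. -/
def sec (x : ℝ) : ℝ := 1 / Real.cos x

/-- The polygamma function of order zero (digamma function) `ψ = Γ' / Γ` on the reals. -/
def digamma (x : ℝ) : ℝ := logDeriv Real.Gamma x

/-- The Pochhammer symbol `(x)_n = x (x + 1) ⋯ (x + n - 1)`. -/
def poch (x : ℝ) (n : ℕ) : ℝ := (ascPochhammer ℝ n).eval x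

/-! ### The system model -/

/-- The Rayleigh law with scale parameter `σ`. -/
def rayleighMeasure (σ : ℝ) : Measure ℝ :=
  volume.withDensity fun x =>
    ENNReal.ofReal (if 0 ≤ x then x / σ ^ 2 * Real.exp (-x ^ 2 / (2 * σ ^ 2)) else 0)

/-- The fading coefficients of an `N`-element surface: `h i` is the channel from the source to the
`i`-th reflection unit and `g i` the one from that unit to the destination. All `2 N` coefficients
are independent, with Rayleigh distributed envelopes of scale parameter `1`. -/
structure IsRayleighChannel {Ω : Type*} [MeasurableSpace Ω] (μ : Measure Ω) {N : ℕ}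
    (h g : Fin N → Ω → ℂ) : Prop where
  law_h : ∀ i, HasLaw (fun ω => ‖h i ω‖) (rayleighMeasure 1) μ
  law_g : ∀ i, HasLaw (fun ω => ‖g i ω‖) (rayleighMeasure 1) μ
  indep : iIndepFun (fun j : Fin N ⊕ Fin N => Sum.elim h g j) μ

/-- The response `exp (-j (φ_h + φ_g))` of a reflection unit (unit gain, optimal phase shift). -/
def response (h g : ℂ) : ℂ := Complex.exp (-(Complex.I * (h.arg + g.arg : ℝ)))

/-- The coefficient of the transmitted symbol in the received signal, `∑ i, h i * g i * r i`. -/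
def coefficient {N : ℕ} (h g : Fin N → ℂ) : ℂ := ∑ i, h i * g i * response (h i) (g i)

/-- The end-to-end channel `A = ∑ i, |h i| |g i|`. -/
def A {N : ℕ} (h g : Fin N → ℂ) : ℝ := ∑ i, ‖h i‖ * ‖g i‖

/-- With the optimal phase shifts the received signal is `A x + n`. -/
theorem coefficient_eq {N : ℕ} (h g : Fin N → ℂ) : coefficient h g = (A h g : ℂ) := by
  unfold coefficient A response
  push_cast
  refine Finset.sum_congr rfl fun i _ => ?_
  have e : Complex.exp (-(Complex.I * ((h i).arg + (g i).arg)))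
      * (Complex.exp ((h i).arg * Complex.I) * Complex.exp ((g i).arg * Complex.I)) = 1 := by
    rw [← Complex.exp_add, ← Complex.exp_add, ← Complex.exp_zero]
    congr 1
    ring
  calc h i * g i * Complex.exp (-(Complex.I * ((h i).arg + (g i).arg)))
      = (‖h i‖ * Complex.exp ((h i).arg * Complex.I))
        * (‖g i‖ * Complex.exp ((g i).arg * Complex.I))
        * Complex.exp (-(Complex.I * ((h i).arg + (g i).arg))) := by
          rw [Complex.norm_mul_exp_arg_mul_I, Complex.norm_mul_exp_arg_mul_I]
    _ = (‖h i‖ : ℂ) * ‖g i‖ * (Complex.exp (-(Complex.I * ((h i).arg + (g i).arg)))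
        * (Complex.exp ((h i).arg * Complex.I) * Complex.exp ((g i).arg * Complex.I))) := by ring
    _ = _ := by rw [e, mul_one]

/-- The instantaneous rate `log₂ (1 + ρ)` at the received signal-to-noise ratio `ρ = ρt A²`. -/
def rate (ρt x : ℝ) : ℝ := Real.logb 2 (1 + ρt * x ^ 2)

/-- The ergodic capacity `E[log₂ (1 + ρt A²)]` of the system, `ρt` being the ratio of the
transmission power to the noise variance. -/
def ergodicCapacity {Ω : Type*} [MeasurableSpace Ω] (μ : Measure Ω) {N : ℕ}
    (h g : Fin N → Ω → ℂ) (ρt : ℝ) : ℝ :=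
  ∫ ω, rate ρt (A (fun i => h i ω) (fun i => g i ω)) ∂μ

/-! ### The closed-form density of the end-to-end channel -/

def k₁ (N : ℕ) : ℝ := N * π / 2

def k₂ (N : ℕ) : ℝ := 4 * N * (1 - π ^ 2 / 16)

def a (N : ℕ) : ℝ := k₁ N ^ 2 / k₂ N - 1

def b (N : ℕ) : ℝ := k₂ N / k₁ N

/-- The closed-form density of `A` on `(0, ∞)`. -/
def fA (N : ℕ) (x : ℝ) : ℝ :=
  x ^ a N / (b N ^ (a N + 1) * Real.Gamma (a N + 1)) * Real.exp (-x / b N)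

/-- The ergodic capacity computed with the closed-form density of `A`. -/
def densityCapacity (N : ℕ) (ρt : ℝ) : ℝ := ∫ y in Set.Ioi (0 : ℝ), rate ρt y * fA N y

/-! ### The approximations -/

/-- The cosecant term of the high-SNR approximation. -/
def cscTerm (N : ℕ) (ρt : ℝ) : ℝ :=
  π * csc (a N * π / 2) /
    (Real.log 2 * (2 + a N) * b N ^ (a N + 2) * Real.Gamma (a N + 1) * ρt ^ (a N / 2 + 1))

/-- The secant term of the high-SNR approximation. -/
def secTerm (N : ℕ) (ρt : ℝ) : ℝ :=
  π * sec (a N * π / 2) /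
    ((a N + 1) * b N ^ (a N + 1) * Real.log 2 * Real.Gamma (a N + 1) * ρt ^ ((a N + 1) / 2))

/-- The high-SNR approximation of the ergodic capacity. -/
def highSNR (N : ℕ) (ρt : ℝ) : ℝ :=
  1 / (Real.log 2 * poch (a N - 1) 2 * b N ^ 2 * ρt)
    + (a N ^ 2 - a N) / poch (a N - 1) 2 * Real.logb 2 (b N ^ 2 * ρt)
    + 2 * (a N ^ 2 - a N) / (Real.log 2 * poch (a N - 1) 2) * digamma (3 + a N)
    + cscTerm N ρt + secTerm N ρt

/-- The high-SNR and high-`N` approximation of the ergodic capacity. -/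
def highSNRHighN (N : ℕ) (ρt : ℝ) : ℝ :=
  1 / (Real.log 2 * poch (a N - 1) 2 * b N ^ 2 * ρt)
    + (a N ^ 2 - a N) / poch (a N - 1) 2 * Real.logb 2 (b N ^ 2 * ρt)
    + 2 * (a N ^ 2 - a N) / (Real.log 2 * poch (a N - 1) 2) * digamma (3 + a N)

end

end RIS

namespace RIS

open scoped Nat

/-! ### Rational approximations to `π ^ 2` -/

/-! Two independent facts are combined: an arithmetic one for the trigonometric terms and a
concentration one for the capacities.

Arithmetic. Here `a N + 1 = shape * N` with `shape = π² / (16 - π²)`, and `b N` does not depend on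
`N`. The cosecant or the secant is large when `shape * N` is close to an integer `m`, and then `π² /
4` is close to the rational `4 m / (N + m)`. A Niven-type argument with Cartwright's integrals
(`lower_bound_pi_sq_sub_div`) bounds such approximations from below. The bound is factorially small,
but for `k = N / 8` it loses only about `(4 k)!` times an exponential, whereas `Γ(shape * N) ≥ N! ≥
(4 k)! k!`. The spare `k!` absorbs every factor `K ^ N`, which gives
`tendsto_pow_div_sin_mul_Gamma`. The same bound shows that `shape * N` is never an integer, so that
nothing is divided by zero.

Concentration. Under the exact law and under the closed-form (gamma) law, `A` has mean `k₁ N`,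
relative variance at most `1 / N`, and inverse moment at most `5 / k₁ N`. By
`abs_integral_rate_sub_le` both capacities are then `log₂ (ρt k₁²)` up to an error of order `1 /
√N`, uniformly in `ρt ≥ ρ₀`. On the other side `(a - 1)_2 = a² - a`, `b (a + 1) = k₁` and `ψ(a + 3)
= log (a + 1) + O(1 / a)`, so `C_{ρ,N}` is close to the same logarithm. -/

/-- Cartwright's integrals at the point `π / 2`. -/
noncomputable def cosMoment (n : ℕ) : ℝ := ∫ x in (-1 : ℝ)..1, (1 - x ^ 2) ^ n * Real.cos (x * (π / 2))

lemma cosMoment_zero : cosMoment 0 * (π / 2) = 2 := by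
  rw [mul_comm, cosMoment]
  simp only [pow_zero, one_mul]
  rw [intervalIntegral.mul_integral_comp_mul_right]
  simp
  norm_num

/-- Two integrations by parts. The truncated `n - 1` is harmless, since its term carries the factor
`n`. -/
lemma cosMoment_succ (n : ℕ) :
    cosMoment (n + 1) * (π / 2) ^ 2 =
      2 * (n + 1) * (2 * n + 1) * cosMoment n - 4 * (n + 1) * n * cosMoment (n - 1) := by
  rw [cosMoment]
  set θ : ℝ := π / 2 with hθ
  let f (x : ℝ) : ℝ := 1 - x ^ 2
  let u₁ (x : ℝ) : ℝ := f x ^ (n + 1)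
  let u₁' (x : ℝ) : ℝ := - (2 * (n + 1) * x * f x ^ n)
  let v₁ (x : ℝ) : ℝ := Real.sin (x * θ)
  let v₁' (x : ℝ) : ℝ := Real.cos (x * θ) * θ
  let u₂ (x : ℝ) : ℝ := x * (f x) ^ n
  let u₂' (x : ℝ) : ℝ := (f x) ^ n - 2 * n * x ^ 2 * (f x) ^ (n - 1)
  let v₂ (x : ℝ) : ℝ := Real.cos (x * θ)
  let v₂' (x : ℝ) : ℝ := -Real.sin (x * θ) * θ
  have hfd : Continuous f := by fun_prop
  have hu₁d : Continuous u₁' := by fun_prop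
  have hv₁d : Continuous v₁' := by fun_prop
  have hu₂d : Continuous u₂' := by fun_prop
  have hv₂d : Continuous v₂' := by fun_prop
  have hu₁_eval_one : u₁ 1 = 0 := by simp only [u₁, f]; simp
  have hu₁_eval_neg_one : u₁ (-1) = 0 := by simp only [u₁, f]; simp
  -- For `n = 0` the polynomial factor does not vanish at the endpoints; the cosine does, because `θ
  -- = π / 2`.
  have t : u₂ 1 * v₂ 1 - u₂ (-1) * v₂ (-1) = 0 := by simp [v₂, hθ]
  have hf (x) : HasDerivAt f (- 2 * x) x := by
    convert! (hasDerivAt_pow 2 x).const_sub 1 using 1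
    simp
  have hu₁ (x) : HasDerivAt u₁ (u₁' x) x := by
    convert! (hf x).pow _ using 1
    simp only [Nat.add_succ_sub_one, u₁', Nat.cast_add_one]
    ring
  have hv₁ (x) : HasDerivAt v₁ (v₁' x) x := (hasDerivAt_mul_const θ).sin
  have hu₂ (x) : HasDerivAt u₂ (u₂' x) x := by
    convert! (hasDerivAt_id' x).fun_mul ((hf x).fun_pow _) using 1
    simp only [u₂']
    ring
  have hv₂ (x) : HasDerivAt v₂ (v₂' x) x := (hasDerivAt_mul_const θ).cos
  convert_to (∫ (x : ℝ) in (-1)..1, u₁ x * v₁' x) * θ = _ using 1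
  · simp_rw [u₁, v₁', f, ← intervalIntegral.integral_mul_const, sq θ, mul_assoc]
  rw [intervalIntegral.integral_mul_deriv_eq_deriv_mul (fun x _ => hu₁ x) (fun x _ => hv₁ x)
    (hu₁d.intervalIntegrable _ _) (hv₁d.intervalIntegrable _ _), hu₁_eval_one, hu₁_eval_neg_one,
    zero_mul, zero_mul, sub_zero, zero_sub, ← intervalIntegral.integral_neg,
    ← intervalIntegral.integral_mul_const]
  convert_to ((-2 : ℝ) * (n + 1)) * ∫ (x : ℝ) in (-1)..1, (u₂ x * v₂' x) = _ using 1
  · rw [← intervalIntegral.integral_const_mul]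
    congr 1 with x
    dsimp [u₁', v₁, u₂, v₂']
    ring
  rw [intervalIntegral.integral_mul_deriv_eq_deriv_mul (fun x _ => hu₂ x) (fun x _ => hv₂ x)
    (hu₂d.intervalIntegrable _ _) (hv₂d.intervalIntegrable _ _), t, zero_sub]
  -- Substitute `x² = 1 - f x`, so that only powers of `f` remain.
  have (x : _) : u₂' x = (2 * n + 1) * f x ^ n - 2 * n * f x ^ (n - 1) := by
    cases n with
    | zero => simp [u₂']
    | succ n => ring!
  simp_rw [this, sub_mul, mul_assoc _ _ (v₂ _)]
  have : Continuous v₂ := by fun_prop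
  rw [intervalIntegral.integral_sub]
  · simp_rw [intervalIntegral.integral_const_mul]
    ring!
  all_goals exact Continuous.intervalIntegrable (by fun_prop) _ _

lemma cosMoment_one : cosMoment 1 * (π / 2) ^ 3 = 4 := by
  have h := cosMoment_succ 0
  have h0 := cosMoment_zero
  simp only [zero_add, Nat.cast_zero] at h
  linear_combination (π / 2) * h + 2 * h0

lemma cosMoment_add_two (n : ℕ) :
    cosMoment (n + 2) * (π / 2) ^ 2 =
      2 * (n + 2) * (2 * n + 3) * cosMoment (n + 1) - 4 * (n + 2) * (n + 1) * cosMoment n := by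
  rw [cosMoment_succ (n + 1)]
  push_cast
  ring!

lemma cosMoment_integrand_nonneg (n : ℕ) {x : ℝ} (h₁ : -1 ≤ x) (h₂ : x ≤ 1) :
    0 ≤ (1 - x ^ 2) ^ n * Real.cos (x * (π / 2)) := by
  refine mul_nonneg (pow_nonneg (by nlinarith) _) ?_
  apply Real.cos_nonneg_of_neg_pi_div_two_le_of_le <;> nlinarith [Real.pi_pos]

/-- On `[-1/2, 1/2]` the two factors are at least `(3/4) ^ n` and `1/2`, and the integrand is
nonnegative elsewhere. -/
lemma le_cosMoment (n : ℕ) : 1 / 2 * (3 / 4 : ℝ) ^ n ≤ cosMoment n := by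
  have hc : Continuous fun x : ℝ => (1 - x ^ 2) ^ n * Real.cos (x * (π / 2)) := by fun_prop
  have h₁ : ∫ x in (-1 / 2 : ℝ)..(1 / 2), (1 - x ^ 2) ^ n * Real.cos (x * (π / 2))
      ≤ cosMoment n := by
    refine intervalIntegral.integral_mono_interval (by norm_num) (by norm_num) (by norm_num) ?_
      (hc.intervalIntegrable _ _)
    refine (ae_restrict_iff' measurableSet_Ioc).2 (Eventually.of_forall fun x hx => ?_)
    exact cosMoment_integrand_nonneg n hx.1.le hx.2
  refine le_trans ?_ h₁
  have h₂ : ∫ x in (-1 / 2 : ℝ)..(1 / 2), 1 / 2 * (3 / 4 : ℝ) ^ n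
      ≤ ∫ x in (-1 / 2 : ℝ)..(1 / 2), (1 - x ^ 2) ^ n * Real.cos (x * (π / 2)) := by
    refine intervalIntegral.integral_mono_on (by norm_num) (by simp) (hc.intervalIntegrable _ _) ?_
    intro x hx
    have hx2 : x ^ 2 ≤ 1 / 4 := by nlinarith [hx.1, hx.2]
    have hcos : (1 / 2 : ℝ) ≤ Real.cos (x * (π / 2)) := by
      have := Real.one_sub_sq_div_two_le_cos (x := x * (π / 2))
      have hp : π ^ 2 ≤ 16 := by nlinarith [Real.pi_pos, Real.pi_le_four]
      nlinarith [mul_le_mul hx2 hp (by positivity) (by norm_num)]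
    rw [mul_comm]
    exact mul_le_mul (pow_le_pow_left₀ (by norm_num) (by linarith) n) hcos (by norm_num)
      (pow_nonneg (by linarith) n)
  refine le_trans (le_of_eq ?_) h₂
  rw [intervalIntegral.integral_const]
  norm_num

lemma cosMoment_le (n : ℕ) : cosMoment n ≤ 2 := by
  have h : ‖cosMoment n‖ ≤ 1 * |1 - (-1)| := by
    refine intervalIntegral.norm_integral_le_of_norm_le_const fun x hx => ?_
    rw [Set.uIoc_of_le (by norm_num)] at hx
    rw [Real.norm_eq_abs, abs_mul, abs_pow]
    refine mul_le_one₀ (pow_le_one₀ (abs_nonneg _) ?_) (abs_nonneg _) (Real.abs_cos_le_one _)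
    rw [abs_le]
    constructor <;> nlinarith [hx.1, hx.2]
  have := (le_abs_self _).trans h
  norm_num at this
  exact this

/-- The polynomials whose value at `π ^ 2 / 4` is a multiple of `cosMoment`. -/
def momentPoly (t : ℝ) : ℕ → ℝ
  | 0 => 2
  | 1 => 4
  | n + 2 => 2 * (2 * n + 3) * momentPoly t (n + 1) - 4 * t * momentPoly t n

/-- The factor `n !` absorbs the `n + 2` and `n + 1` of the recursion for `cosMoment`, which leaves
integer coefficients in `momentPoly`. -/
lemma momentPoly_pi : ∀ n : ℕ,
    momentPoly ((π / 2) ^ 2) n * n ! = cosMoment n * (π / 2) ^ (2 * n + 1)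
  | 0 => by simp [momentPoly, cosMoment_zero]
  | 1 => by simp [momentPoly, cosMoment_one]
  | n + 2 => by
    have h₀ := momentPoly_pi n
    have h₁ := momentPoly_pi (n + 1)
    have h := cosMoment_add_two n
    have e : cosMoment (n + 2) * (π / 2) ^ (2 * (n + 2) + 1)
        = 2 * (n + 2) * (2 * n + 3) * (cosMoment (n + 1) * (π / 2) ^ (2 * (n + 1) + 1))
          - 4 * (n + 2) * (n + 1) * (π / 2) ^ 2 * (cosMoment n * (π / 2) ^ (2 * n + 1)) := by
      linear_combination (π / 2) ^ (2 * n + 3) * h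
    rw [e, ← h₀, ← h₁, momentPoly, Nat.factorial_succ (n + 1), Nat.factorial_succ n]
    push_cast
    ring

/-- Induction step for the size and for the Lipschitz constant of `momentPoly` on `|t| ≤ 4`. The
size needs the coefficient `4 |t| ≤ 16`; the differences need `16 + 4 = 20`, as the factor `t`
varies too. -/
lemma factorial_bound_step (n : ℕ) :
    (4 * n + 6) * (2 * 22 ^ (n + 1) * ((n + 1)! : ℝ)) + 20 * (2 * 22 ^ n * (n ! : ℝ))
      ≤ 2 * 22 ^ (n + 2) * ((n + 2)! : ℝ) := by
  rw [Nat.factorial_succ (n + 1), Nat.factorial_succ n]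
  push_cast
  have h : (0 : ℝ) < 22 ^ n * (n ! : ℝ) := by positivity
  have hn : (0 : ℝ) ≤ n := n.cast_nonneg
  rw [pow_succ _ (n + 1), pow_succ _ n]
  have : (4 * n + 6) * (2 * (22 * ((n : ℝ) + 1))) + 40
      ≤ 2 * 22 * 22 * ((n + 1 + 1) * (n + 1)) := by nlinarith
  linarith [mul_le_mul_of_nonneg_right this h.le]

lemma abs_momentPoly_le {t : ℝ} (ht : |t| ≤ 4) : ∀ n : ℕ,
    |momentPoly t n| ≤ 2 * 22 ^ n * (n ! : ℝ)
  | 0 => by simp [momentPoly]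
  | 1 => by simp [momentPoly]; norm_num
  | n + 2 => by
    refine le_trans ?_ (factorial_bound_step n)
    have h₀ := abs_momentPoly_le ht n
    have h₁ := abs_momentPoly_le ht (n + 1)
    rw [momentPoly]
    refine (abs_sub _ _).trans ?_
    rw [abs_mul, abs_mul (4 * t), abs_mul 4 t, abs_of_nonneg (by positivity : (0:ℝ) ≤ 2 * (2 * n + 3)),
      abs_of_nonneg (by norm_num : (0 : ℝ) ≤ 4)]
    have := mul_le_mul ht h₀ (abs_nonneg _) (by norm_num)
    nlinarith [mul_le_mul_of_nonneg_left h₁ (by positivity : (0 : ℝ) ≤ 4 * n + 6),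
      (by positivity : (0 : ℝ) ≤ 2 * 22 ^ n * (n ! : ℝ))]

lemma abs_momentPoly_sub_le {s t : ℝ} (hs : |s| ≤ 4) (ht : |t| ≤ 4) : ∀ n : ℕ,
    |momentPoly s n - momentPoly t n| ≤ 2 * 22 ^ n * (n ! : ℝ) * |s - t|
  | 0 => by simp [momentPoly]
  | 1 => by simp [momentPoly]
  | n + 2 => by
    have h₀ := abs_momentPoly_sub_le hs ht n
    have h₁ := abs_momentPoly_sub_le hs ht (n + 1)
    have h₂ := abs_momentPoly_le ht n
    have e : momentPoly s (n + 2) - momentPoly t (n + 2)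
        = (4 * n + 6) * (momentPoly s (n + 1) - momentPoly t (n + 1))
          - (4 * (s * (momentPoly s n - momentPoly t n)) + 4 * ((s - t) * momentPoly t n)) := by
      rw [momentPoly, momentPoly]; ring
    have g₁ := mul_le_mul_of_nonneg_left h₁ (by positivity : (0 : ℝ) ≤ 4 * n + 6)
    have g₀ := mul_le_mul hs h₀ (abs_nonneg _) (by norm_num)
    have g₂ := mul_le_mul_of_nonneg_left h₂ (abs_nonneg (s - t))
    have g := mul_le_mul_of_nonneg_right (factorial_bound_step n) (abs_nonneg (s - t))
    rw [e]
    refine (abs_sub _ _).trans ?_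
    rw [abs_mul, abs_of_nonneg (by positivity : (0:ℝ) ≤ 4 * n + 6)]
    have g₃ := abs_add_le (4 * (s * (momentPoly s n - momentPoly t n)))
      (4 * ((s - t) * momentPoly t n))
    simp only [abs_mul, abs_of_nonneg (by norm_num : (0 : ℝ) ≤ 4)] at g₃
    linarith

/-- The coefficients are integers and the degree in `t` grows only every second step, so `q ^ k`
clears the denominators at both indices `2 k` and `2 k + 1`. -/
lemma momentPoly_div_int (p q : ℕ) (hq : 0 < q) (k : ℕ) :
    (∃ z : ℤ, momentPoly (p / q) (2 * k) * q ^ k = z) ∧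
      ∃ z : ℤ, momentPoly (p / q) (2 * k + 1) * q ^ k = z := by
  have hq' : (q : ℝ) ≠ 0 := by positivity
  induction k with
  | zero => exact ⟨⟨2, by simp [momentPoly]⟩, ⟨4, by simp [momentPoly]⟩⟩
  | succ k ih =>
    obtain ⟨⟨y, hy⟩, ⟨z, hz⟩⟩ := ih
    have e : momentPoly (p / q) (2 * (k + 1)) * q ^ (k + 1)
        = ((2 * (4 * k + 3) * z * q - 4 * p * y : ℤ) : ℝ) := by
      push_cast
      rw [← hy, ← hz, show 2 * (k + 1) = 2 * k + 2 by ring, momentPoly]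
      push_cast
      field_simp
      ring
    refine ⟨⟨_, e⟩, ⟨2 * (4 * k + 5) * (2 * (4 * k + 3) * z * q - 4 * p * y) - 4 * p * z, ?_⟩⟩
    rw [Int.cast_sub, Int.cast_mul, ← e]
    push_cast
    rw [← hz, show 2 * (k + 1) + 1 = 2 * k + 1 + 2 by ring, momentPoly,
      show 2 * (k + 1) = 2 * k + 1 + 1 by ring]
    push_cast
    field_simp
    ring

/-- An effective lower bound for the distance from `π ^ 2 / 4` to a rational number. -/
theorem lower_bound_pi_sq_sub_div {p q k : ℕ} (hq : 0 < q) (hpq : p ≤ 4 * q)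
    (hk : 8 * (7 * q) ^ k ≤ (2 * k)!) :
    1 / (4 * 900 ^ k * ((2 * k)! : ℝ) ^ 2) ≤ |(p : ℝ) / q - (π / 2) ^ 2| := by
  have hq' : (0 : ℝ) < q := by exact_mod_cast hq
  have hF : (0 : ℝ) < ((2 * k)! : ℝ) := by positivity
  set F : ℝ := ((2 * k)! : ℝ) with hFdef
  have hk' : 8 * (7 * (q : ℝ)) ^ k ≤ F := by rw [hFdef]; exact_mod_cast hk
  have hpi3 : 3 < π := Real.pi_gt_three
  have hpi4 : π < 3.15 := Real.pi_lt_d2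
  have hs : |(p : ℝ) / q| ≤ 4 := by
    rw [abs_of_nonneg (by positivity), div_le_iff₀ hq']
    exact_mod_cast hpq
  have ht : |(π / 2) ^ 2| ≤ 4 := by
    rw [abs_of_nonneg (by positivity)]; nlinarith
  have hL := abs_momentPoly_sub_le hs ht (2 * k)
  rw [← hFdef] at hL
  have hP : momentPoly ((π / 2) ^ 2) (2 * k)
      = cosMoment (2 * k) * (π / 2) ^ (2 * (2 * k) + 1) / F := by
    rw [eq_div_iff hF.ne', ← momentPoly_pi]
  have hpow : (π / 2) ^ (2 * (2 * k) + 1) ≤ 2 * 7 ^ k := by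
    rw [pow_succ, ← mul_assoc, pow_mul, mul_comm]
    have : (π / 2) ^ (2 * 2) ≤ 7 := by
      have : (π / 2) ^ 2 ≤ 2.49 := by nlinarith
      calc (π / 2) ^ (2 * 2) = ((π / 2) ^ 2) ^ 2 := by ring
        _ ≤ 2.49 ^ 2 := by gcongr
        _ ≤ 7 := by norm_num
    gcongr
    linarith
  have hlow : (9 / 16 : ℝ) ^ k / (2 * F) ≤ momentPoly ((π / 2) ^ 2) (2 * k) := by
    rw [hP, div_le_div_iff₀ (by positivity) hF]
    have h₁ := le_cosMoment (2 * k)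
    rw [pow_mul] at h₁
    norm_num at h₁
    have h₂ : 1 ≤ (π / 2) ^ (2 * (2 * k) + 1) := one_le_pow₀ (by linarith)
    have h₃ : (9 / 16 : ℝ) ^ k ≤ 2 * (cosMoment (2 * k) * (π / 2) ^ (2 * (2 * k) + 1)) := by
      have h0 : (0 : ℝ) < (9 / 16) ^ k := by positivity
      nlinarith
    nlinarith
  -- Here `hk` enters: the value at `π² / 4` is at most half of `1 / q ^ k`, the least nonzero
  -- absolute value possible at `p / q`.
  have hup : momentPoly ((π / 2) ^ 2) (2 * k) ≤ 1 / 2 / q ^ k := by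
    rw [hP, div_le_div_iff₀ hF (by positivity)]
    have h₁ := cosMoment_le (2 * k)
    have h₂ : cosMoment (2 * k) * (π / 2) ^ (2 * (2 * k) + 1) ≤ 2 * (2 * 7 ^ k) :=
      mul_le_mul h₁ hpow (by positivity) (by norm_num)
    calc _ ≤ 2 * (2 * 7 ^ k) * (q : ℝ) ^ k := by gcongr
      _ = 1 / 2 * (8 * (7 * (q : ℝ)) ^ k) := by rw [mul_pow]; ring
      _ ≤ _ := by gcongr
  have hpos : 0 ≤ momentPoly ((π / 2) ^ 2) (2 * k) := le_trans (by positivity) hlow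
  -- The value at `p / q` is an integer over `q ^ k`. If it is zero, `hlow` gives the gap; otherwise
  -- it exceeds the value at `π² / 4` in modulus by at least `1 / (2 q ^ k)`.
  have key : (9 / 16 : ℝ) ^ k / (2 * F)
      ≤ |momentPoly (p / q) (2 * k) - momentPoly ((π / 2) ^ 2) (2 * k)| := by
    obtain ⟨z, hz⟩ := (momentPoly_div_int p q hq k).1
    rcases eq_or_ne z 0 with rfl | h0
    · have : momentPoly (p / q) (2 * k) = 0 := by
        rw [Int.cast_zero] at hz
        exact (mul_eq_zero.1 hz).resolve_right (by positivity)
      rw [this, zero_sub, abs_neg, abs_of_nonneg hpos]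
      exact hlow
    · have h₁ : 1 / (q : ℝ) ^ k ≤ |momentPoly (p / q) (2 * k)| := by
        rw [div_le_iff₀ (by positivity), ← abs_of_pos (by positivity : (0 : ℝ) < (q : ℝ) ^ k),
          ← abs_mul, hz]
        exact_mod_cast Int.one_le_abs h0
      have h₂ := abs_sub_abs_le_abs_sub (momentPoly (p / q) (2 * k))
        (momentPoly ((π / 2) ^ 2) (2 * k))
      rw [abs_of_nonneg hpos] at h₂
      have h₃ : 1 / (q : ℝ) ^ k - 1 / 2 / q ^ k = 1 / (2 * q ^ k) := by field_simp; norm_num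
      have h₄ : (9 / 16 : ℝ) ^ k / (2 * F) ≤ 1 / (2 * q ^ k) := by
        apply div_le_div₀ zero_le_one (pow_le_one₀ (by norm_num) (by norm_num)) (by positivity)
        have : (q : ℝ) ^ k ≤ F := by
          refine le_trans ?_ hk'
          calc (q : ℝ) ^ k ≤ (7 * (q : ℝ)) ^ k := by gcongr; linarith
            _ ≤ _ := by linarith [(by positivity : (0 : ℝ) < (7 * (q : ℝ)) ^ k)]
        linarith
      linarith
  have h := key.trans hL
  -- The constant 900 is a round number above `22² * 16 / 9`.
  have e900 : (22 : ℝ) ^ (2 * k) * 1 ≤ 900 ^ k * (9 / 16) ^ k := by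
    rw [pow_mul, ← mul_pow, mul_one]
    gcongr
    norm_num
  rw [div_le_iff₀ (by positivity)] at h ⊢
  have h9 : (0 : ℝ) < (9 / 16) ^ k := by positivity
  have h22 : (0 : ℝ) < 22 ^ (2 * k) := by positivity
  refine le_of_mul_le_mul_left ?_ h9
  calc (9 / 16 : ℝ) ^ k * 1 ≤ 2 * 22 ^ (2 * k) * F * |(p : ℝ) / q - (π / 2) ^ 2| * (2 * F) := by
        rw [mul_one]; exact h
    _ = (22 ^ (2 * k) * 1) * (4 * F ^ 2 * |(p : ℝ) / q - (π / 2) ^ 2|) := by ring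
    _ ≤ (900 ^ k * (9 / 16) ^ k) * (4 * F ^ 2 * |(p : ℝ) / q - (π / 2) ^ 2|) := by gcongr
    _ = _ := by ring

end RIS

namespace RIS

open scoped Nat

/-! ### The parameters of the closed-form density -/

/-- The shape of the closed-form density per reflection unit. -/
noncomputable def shape : ℝ := π ^ 2 / (16 - π ^ 2)

lemma pi_sq_bounds : 9 < π ^ 2 ∧ π ^ 2 < 10 := by
  have h3 := Real.pi_gt_three
  have h4 := Real.pi_lt_d2
  constructor <;> nlinarith

lemma shape_bounds : 9 / 7 < shape ∧ shape < 5 / 3 := by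
  obtain ⟨h₁, h₂⟩ := pi_sq_bounds
  rw [shape]
  constructor
  · rw [lt_div_iff₀ (by linarith)]; linarith
  · rw [div_lt_iff₀ (by linarith)]; linarith

lemma a_add_one {N : ℕ} (hN : 1 ≤ N) : a N + 1 = shape * N := by
  obtain ⟨h₁, h₂⟩ := pi_sq_bounds
  have hN' : (N : ℝ) ≠ 0 := by positivity
  have h : (16 - π ^ 2 : ℝ) ≠ 0 := by linarith
  have h' : (1 - π ^ 2 / 16 : ℝ) ≠ 0 := by
    intro h0; apply h; linarith
  rw [a, k₁, k₂, shape, sub_add_cancel]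
  field_simp
  ring

lemma b_eq {N : ℕ} (hN : 1 ≤ N) : b N = (16 - π ^ 2) / (2 * π) := by
  have hN' : (N : ℝ) ≠ 0 := by positivity
  rw [b, k₁, k₂]
  field_simp
  ring

lemma b_pos {N : ℕ} (hN : 1 ≤ N) : 0 < b N := by
  obtain ⟨h₁, h₂⟩ := pi_sq_bounds
  rw [b_eq hN]
  have : 0 < 16 - π ^ 2 := by linarith
  positivity

lemma a_pos {N : ℕ} (hN : 1 ≤ N) : 0 < a N := by
  have h := a_add_one hN
  have : (1 : ℝ) ≤ N := by exact_mod_cast hN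
  nlinarith [shape_bounds.1]

lemma k₁_pos {N : ℕ} (hN : 1 ≤ N) : 0 < k₁ N := by
  have hN' : (0 : ℝ) < N := by positivity
  rw [k₁]; positivity

lemma b_mul_a_add_one {N : ℕ} (hN : 1 ≤ N) : b N * (a N + 1) = k₁ N := by
  obtain ⟨h₁, h₂⟩ := pi_sq_bounds
  have h : (16 - π ^ 2 : ℝ) ≠ 0 := by linarith
  rw [a_add_one hN, b_eq hN, k₁, shape]
  field_simp

/-! ### The distance of the shape parameter from the integers -/

/-- `shape * N` close to the integer `m` means `π ^ 2 / 4` close to `4 m / (N + m)`. -/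
lemma abs_div_sub_pi_sq_le {N m : ℕ} (hN : 1 ≤ N) :
    |((4 * m : ℕ) : ℝ) / ((N + m : ℕ) : ℝ) - (π / 2) ^ 2| ≤ 4 * |shape * N - m| := by
  obtain ⟨h₁, h₂⟩ := pi_sq_bounds
  have hs := shape_bounds.1
  have hN' : (1 : ℝ) ≤ N := by exact_mod_cast hN
  have hm : (0 : ℝ) ≤ m := m.cast_nonneg
  have h : (16 - π ^ 2 : ℝ) ≠ 0 := by linarith
  -- The map `s ↦ 4 s / (1 + s)` takes `shape` to `π² / 4` and `m / N` to `4 m / (N + m)`.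
  have hpi : (π / 2) ^ 2 = 4 * shape / (1 + shape) := by
    rw [shape]
    field_simp
    ring
  have hd : ((4 * m : ℕ) : ℝ) / ((N + m : ℕ) : ℝ) - (π / 2) ^ 2
      = (m - shape * N) * (4 / ((N + m) * (1 + shape))) := by
    rw [hpi]
    push_cast
    have : (N : ℝ) + m ≠ 0 := by positivity
    have : 1 + shape ≠ 0 := by positivity
    field_simp
    ring
  have hc : 4 / ((N + m) * (1 + shape)) ≤ 4 := by
    rw [div_le_iff₀ (by positivity)]
    nlinarith
  rw [hd, abs_mul, abs_sub_comm, mul_comm, abs_of_nonneg (by positivity :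
    0 ≤ 4 / ((N + m) * (1 + shape)))]
  gcongr

/-- Take the nearest integer, reduce by periodicity to `|x - m| ≤ 1/2`, and apply Jordan's
inequality. -/
lemma exists_nat_two_mul_le_abs_sin {x : ℝ} (hx : 0 ≤ x) :
    ∃ m : ℕ, (m : ℝ) ≤ x + 1 / 2 ∧ 2 * |x - m| ≤ |Real.sin (x * π)| := by
  obtain ⟨m, hm⟩ : ∃ m : ℕ, round x = m := by
    refine ⟨(round x).toNat, (Int.toNat_of_nonneg ?_).symm⟩
    rw [round_eq]
    exact Int.floor_nonneg.2 (by linarith)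
  have hr := abs_sub_round x
  rw [hm, Int.cast_natCast] at hr
  refine ⟨m, by linarith [neg_abs_le (x - m)], ?_⟩
  have hs : |Real.sin (x * π)| = Real.sin (|x - m| * π) := by
    have h₁ : |Real.sin (x * π)| = |Real.sin ((x - m) * π)| := by
      rw [sub_mul, Real.sin_sub_nat_mul_pi, abs_mul, abs_pow]
      simp
    rw [h₁]
    have hsn : 0 ≤ Real.sin (|x - m| * π) :=
      Real.sin_nonneg_of_nonneg_of_le_pi (by positivity) (by nlinarith [Real.pi_pos])
    rcases abs_cases (x - m) with ⟨h, _⟩ | ⟨h, _⟩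
    · rw [h] at hsn ⊢
      exact abs_of_nonneg hsn
    · rw [h] at hsn ⊢
      rw [neg_mul, Real.sin_neg] at hsn ⊢
      exact abs_of_nonpos (by linarith)
  rw [hs]
  have h := Real.mul_le_sin (x := |x - m| * π) (by positivity) (by nlinarith [Real.pi_pos])
  refine le_trans (le_of_eq ?_) h
  field_simp

lemma eventually_pow_le_factorial (c : ℝ) : ∀ᶠ k : ℕ in atTop, 8 * c ^ k ≤ (k ! : ℝ) := by
  have h := (FloorSemiring.tendsto_pow_div_factorial_atTop c).eventually_lt_const
    (show (0 : ℝ) < 1 / 8 by norm_num)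
  filter_upwards [h] with k hk
  rw [div_lt_iff₀ (by positivity)] at hk
  linarith

/-- A zero would make `π² / 4` equal to a rational; the lower bound, for any sufficiently large `k`,
excludes this. -/
lemma sin_shape_mul_ne_zero {N : ℕ} (hN : 1 ≤ N) : Real.sin (shape * N * π) ≠ 0 := by
  intro h0
  have hs := shape_bounds
  obtain ⟨m, -, hm⟩ := exists_nat_two_mul_le_abs_sin (x := shape * N)
    (mul_nonneg (by linarith) N.cast_nonneg)
  rw [h0, abs_zero] at hm
  obtain ⟨k, hk⟩ := (eventually_pow_le_factorial (7 * (N + m : ℕ))).exists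
  have hk' : 8 * (7 * (N + m)) ^ k ≤ (2 * k)! := by
    have : 8 * (7 * (N + m)) ^ k ≤ k ! := by exact_mod_cast hk
    exact this.trans (Nat.factorial_le (by omega))
  have h := lower_bound_pi_sq_sub_div (p := 4 * m) (q := N + m) (by omega) (by omega) hk'
  have h2 := abs_div_sub_pi_sq_le (m := m) hN
  have h3 : (0 : ℝ) < 1 / (4 * 900 ^ k * ((2 * k)! : ℝ) ^ 2) := by positivity
  linarith

/-- The choice `k = N / 8` is large enough for the factorial condition on `q = N + m ≤ 3 N`, and
small enough that `(2 k)!² ≤ (4 k)!` stays well below `N!`. -/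
lemma le_abs_sin_shape_mul : ∀ᶠ N : ℕ in atTop,
    1 / (8 * 900 ^ (N / 8) * ((4 * (N / 8))! : ℝ)) ≤ |Real.sin (shape * N * π)| := by
  have hdiv : Tendsto (fun N : ℕ => N / 8) atTop atTop :=
    Nat.tendsto_div_const_atTop (by norm_num)
  filter_upwards [hdiv.eventually (eventually_pow_le_factorial 336), eventually_ge_atTop 8]
    with N hN h8
  set k := N / 8 with hk
  have hs := shape_bounds
  have hN' : (8 : ℝ) ≤ N := by exact_mod_cast h8
  obtain ⟨m, hmx, hm⟩ := exists_nat_two_mul_le_abs_sin (x := shape * N)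
    (mul_nonneg (by linarith) N.cast_nonneg)
  have hm2 : m ≤ 2 * N := by
    have : (m : ℝ) ≤ 2 * N := by nlinarith
    exact_mod_cast this
  have hk' : 8 * (7 * (N + m)) ^ k ≤ (2 * k)! := by
    have h1 : 8 * 336 ^ k ≤ k ! := by exact_mod_cast hN
    calc 8 * (7 * (N + m)) ^ k ≤ 8 * (336 * (k + 1)) ^ k := by
          gcongr 8 * ?_ ^ k; omega
      _ = 8 * 336 ^ k * (k + 1) ^ k := by rw [mul_pow]; ring
      _ ≤ k ! * (k + 1) ^ k := by gcongr
      _ ≤ (k + k)! := Nat.factorial_mul_pow_le_factorial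
      _ = _ := by rw [two_mul]
  have h := lower_bound_pi_sq_sub_div (p := 4 * m) (q := N + m) (by omega) (by omega) hk'
  have h2 := abs_div_sub_pi_sq_le (m := m) (show 1 ≤ N by omega)
  have h3 : ((2 * k)! : ℝ) ^ 2 ≤ ((4 * k)! : ℝ) := by
    have := Nat.le_of_dvd (Nat.factorial_pos _) (Nat.factorial_mul_factorial_dvd_factorial_add (2 * k) (2 * k))
    rw [show 2 * k + 2 * k = 4 * k by ring, ← sq] at this
    exact_mod_cast this
  have h4 : 1 / (4 * 900 ^ k * ((4 * k)! : ℝ)) ≤ 1 / (4 * 900 ^ k * ((2 * k)! : ℝ) ^ 2) := by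
    gcongr
  have h5 : 1 / (8 * 900 ^ k * ((4 * k)! : ℝ)) = 1 / (4 * 900 ^ k * ((4 * k)! : ℝ)) / 2 := by
    field_simp; norm_num
  rw [h5]
  linarith

lemma factorial_le_Gamma {N : ℕ} (hN : 4 ≤ N) : (N ! : ℝ) ≤ Real.Gamma (shape * N) := by
  have hN' : (4 : ℝ) ≤ N := by exact_mod_cast hN
  have hs := shape_bounds.1
  rw [← Real.Gamma_nat_eq_factorial]
  refine Real.Gamma_strictMonoOn_Ici.monotoneOn ?_ ?_ ?_
  · rw [Set.mem_Ici]; linarith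
  · rw [Set.mem_Ici]; nlinarith
  · nlinarith

lemma tendsto_Gamma_shape_mul :
    Tendsto (fun N : ℕ => Real.Gamma (shape * N)) atTop atTop := by
  refine tendsto_atTop_mono' atTop ?_ tendsto_natCast_atTop_atTop
  filter_upwards [eventually_ge_atTop 4] with N hN
  refine le_trans ?_ (factorial_le_Gamma hN)
  exact_mod_cast Nat.self_le_factorial N

/-- `1 / Γ` beats the small denominators coming from the zeros of the sine. -/
theorem tendsto_pow_div_sin_mul_Gamma (K : ℝ) (hK : 1 ≤ K) :
    Tendsto (fun N : ℕ => K ^ N / (|Real.sin (shape * N * π)| * Real.Gamma (shape * N)))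
      atTop (𝓝 0) := by
  have hdiv : Tendsto (fun N : ℕ => N / 8) atTop atTop :=
    Nat.tendsto_div_const_atTop (by norm_num)
  have hlim := ((FloorSemiring.tendsto_pow_div_factorial_atTop (900 * K ^ 8)).comp
    hdiv).const_mul (8 * K ^ 8)
  rw [mul_zero] at hlim
  refine squeeze_zero' ?_ ?_ hlim
  · filter_upwards [eventually_ge_atTop 4] with N hN
    have := (Nat.cast_nonneg (α := ℝ) (N !)).trans (factorial_le_Gamma hN)
    positivity
  · filter_upwards [le_abs_sin_shape_mul, eventually_ge_atTop 8] with N hN h8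
    simp only [Function.comp_apply]
    set k := N / 8 with hk
    -- Since `5 k ≤ N`, a factor `k !` is left over after `(4 k)!` cancels the loss in the sine.
    have h1 : ((4 * k)! : ℝ) * (k ! : ℝ) ≤ (N ! : ℝ) := by
      have h2 : (4 * k)! * k ! ≤ (4 * k + k)! :=
        Nat.le_of_dvd (Nat.factorial_pos _) (Nat.factorial_mul_factorial_dvd_factorial_add _ _)
      have h3 : (4 * k + k)! ≤ N ! := Nat.factorial_le (by omega)
      exact_mod_cast h2.trans h3
    have hG := h1.trans (factorial_le_Gamma (by omega : 4 ≤ N))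
    have hK0 : (0 : ℝ) < K := by linarith
    have hpos : (0 : ℝ) < 8 * 900 ^ k * ((4 * k)! : ℝ) := by positivity
    have hprod : 1 / (8 * 900 ^ k * ((4 * k)! : ℝ)) * (((4 * k)! : ℝ) * (k ! : ℝ))
        ≤ |Real.sin (shape * N * π)| * Real.Gamma (shape * N) :=
      mul_le_mul hN hG (by positivity) (abs_nonneg _)
    have hKN : K ^ N ≤ K ^ (8 * k + 8) := pow_le_pow_right₀ hK (by omega)
    calc K ^ N / (|Real.sin (shape * N * π)| * Real.Gamma (shape * N))
        ≤ K ^ (8 * k + 8)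
          / (1 / (8 * 900 ^ k * ((4 * k)! : ℝ)) * (((4 * k)! : ℝ) * (k ! : ℝ))) := by
          gcongr
      _ = 8 * K ^ 8 * ((900 * K ^ 8) ^ k / (k ! : ℝ)) := by
          rw [mul_pow, ← pow_mul, pow_add]
          field_simp

end RIS

namespace RIS

/-! ### The logarithm of a concentrated random variable -/

/-- For `y ≥ 1`, `log y = 2 log √y ≤ 2 (√y - 1)`; inversion handles `x < 1`. -/
lemma log_sq_le {x : ℝ} (hx : 0 < x) : Real.log x ^ 2 ≤ 4 * (x + x⁻¹) := by
  have key : ∀ y : ℝ, 1 ≤ y → Real.log y ^ 2 ≤ 4 * y := fun y hy => by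
    have h0 : 0 < √y := Real.sqrt_pos.2 (by linarith)
    have h1 := Real.log_le_sub_one_of_pos h0
    rw [Real.log_sqrt (by linarith)] at h1
    have h2 := Real.log_nonneg hy
    nlinarith [Real.sq_sqrt (by linarith : 0 ≤ y)]
  have hi : 0 < x⁻¹ := inv_pos.2 hx
  rcases le_total 1 x with h | h
  · linarith [key x h]
  · have := key x⁻¹ ((one_le_inv₀ hx).2 h)
    rw [Real.log_inv, neg_sq] at this
    linarith

/-- A quadratic minorant of the logarithm at 1, with `x⁻¹` controlling the singularity at 0. For `x
≥ 1/2` it follows from `log x ≥ 1 - 1/x`. For `x ≤ 1/2`, completing the square gives `-log x ≤ η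
log² x + 1 / (4 η)`, and `1/4 ≤ (x - 1)²`. With `η²` bounding the variance, both penalty terms have
mean `O(η)`. -/
lemma le_log_of_pos {x η : ℝ} (hx : 0 < x) (hη : 0 < η) :
    (x - 1) - (2 + η⁻¹) * (x - 1) ^ 2 - 4 * η * (x + x⁻¹) ≤ Real.log x := by
  have hl := log_sq_le hx
  have hη' : 0 < η⁻¹ := inv_pos.2 hη
  have hx' : 0 < x⁻¹ := inv_pos.2 hx
  have hsq := mul_nonneg hη'.le (sq_nonneg (x - 1))
  rcases le_total (1 / 2) x with h | h
  · have h1 := Real.one_sub_inv_le_log_of_pos hx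
    have h2 : 1 - x⁻¹ = (x - 1) - (x - 1) ^ 2 * x⁻¹ := by field_simp; ring
    have h3 : x⁻¹ ≤ 2 := by
      rw [inv_le_comm₀ hx (by norm_num)]; linarith
    nlinarith [mul_le_mul_of_nonneg_left h3 (sq_nonneg (x - 1)),
      mul_pos hη (by positivity : 0 < x + x⁻¹)]
  · have h1 : -Real.log x ≤ η * Real.log x ^ 2 + η⁻¹ / 4 := by
      have : 0 ≤ η * (Real.log x + η⁻¹ / 2) ^ 2 := by positivity
      have e : η * (Real.log x + η⁻¹ / 2) ^ 2
          = η * Real.log x ^ 2 + Real.log x + η⁻¹ / 4 := by field_simp; ring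
      linarith
    have h2 : (1 / 4 : ℝ) ≤ (x - 1) ^ 2 := by nlinarith
    nlinarith [mul_le_mul_of_nonneg_left h2 hη'.le, mul_le_mul_of_nonneg_left hl hη.le]

section Concentration

variable {Ω : Type*} [MeasurableSpace Ω] {P : Measure Ω} [IsProbabilityMeasure P]

/-- The upper bound is `log y ≤ y - 1`. The lower bound drops `ε` and integrates `le_log_of_pos`,
whose linear term has mean zero. -/
lemma abs_integral_log_le {X : Ω → ℝ} (hpos : ∀ᵐ ω ∂P, 0 < X ω) (h1 : Integrable X P)
    (h2 : Integrable (fun ω => X ω ^ 2) P) (hi : Integrable (fun ω => (X ω)⁻¹) P)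
    {η K : ℝ} (hη : 0 < η) (e1 : ∫ ω, X ω ∂P = 1) (e2 : ∫ ω, X ω ^ 2 ∂P ≤ 1 + η ^ 2)
    (ei : ∫ ω, (X ω)⁻¹ ∂P ≤ K) {ε : ℝ} (hε : 0 ≤ ε) :
    Integrable (fun ω => Real.log (ε + X ω ^ 2)) P ∧
      |∫ ω, Real.log (ε + X ω ^ 2) ∂P| ≤ ε + 4 * η ^ 2 + η * (10 + 8 * K) := by
  have hK : 0 ≤ K := le_trans (integral_nonneg_of_ae (by
    filter_upwards [hpos] with ω hω using (inv_pos.2 hω).le)) ei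
  have hup : ∀ᵐ ω ∂P, Real.log (ε + X ω ^ 2) ≤ ε + X ω ^ 2 - 1 := by
    filter_upwards [hpos] with ω hω
    exact Real.log_le_sub_one_of_pos (by positivity)
  have hlog : ∀ᵐ ω ∂P, 2 * Real.log (X ω) ≤ Real.log (ε + X ω ^ 2) := by
    filter_upwards [hpos] with ω hω
    have : Real.log (X ω ^ 2) ≤ Real.log (ε + X ω ^ 2) :=
      Real.log_le_log (by positivity) (by linarith)
    rwa [Real.log_pow] at this
  have hint : Integrable (fun ω => Real.log (ε + X ω ^ 2)) P := by
    refine Integrable.mono' (((integrable_const ε).add h2).add (hi.const_mul 2)) ?_ ?_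
    · exact (Real.measurable_log.comp_aemeasurable
        ((h2.aestronglyMeasurable.aemeasurable).const_add ε)).aestronglyMeasurable
    · filter_upwards [hpos, hup, hlog] with ω hω hu hl
      have h3 := Real.one_sub_inv_le_log_of_pos hω
      have h4 := inv_pos.2 hω
      rw [Real.norm_eq_abs, abs_le]
      simp only [Pi.add_apply]
      constructor <;> nlinarith [sq_nonneg (X ω)]
  refine ⟨hint, ?_⟩
  have hη' : 0 < η⁻¹ := inv_pos.2 hη
  have hU : ∫ ω, Real.log (ε + X ω ^ 2) ∂P ≤ ε + η ^ 2 := by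
    have h := integral_mono_ae hint (((integrable_const ε).add h2).sub (integrable_const 1)) hup
    rw [integral_sub' ((integrable_const ε).add h2) (integrable_const 1),
      integral_add' (integrable_const ε) h2] at h
    simp only [integral_const, probReal_univ, smul_eq_mul, one_mul] at h
    linarith
  have hLo : -(4 * η ^ 2 + η * (10 + 8 * K)) ≤ ∫ ω, Real.log (ε + X ω ^ 2) ∂P := by
    have hf : Integrable (fun ω => 2 * ((X ω - 1)
        - (2 + η⁻¹) * (X ω ^ 2 - 2 * X ω + 1) - 4 * η * (X ω + (X ω)⁻¹))) P := by fun_prop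
    have h := integral_mono_ae hf hint (by
      filter_upwards [hpos, hlog] with ω hω hl
      have := le_log_of_pos hω hη
      nlinarith)
    have hval : ∫ ω, 2 * ((X ω - 1)
        - (2 + η⁻¹) * (X ω ^ 2 - 2 * X ω + 1) - 4 * η * (X ω + (X ω)⁻¹)) ∂P
        = 2 * ((1 - 1) - (2 + η⁻¹) * (∫ ω, X ω ^ 2 ∂P - 2 * 1 + 1)
          - 4 * η * (1 + ∫ ω, (X ω)⁻¹ ∂P)) := by
      rw [integral_const_mul, integral_sub (by fun_prop) (by fun_prop),
        integral_sub (by fun_prop) (by fun_prop), integral_sub (by fun_prop) (by fun_prop),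
        integral_const_mul, integral_const_mul, integral_add (by fun_prop) (by fun_prop),
        integral_add (by fun_prop) (by fun_prop), integral_sub (by fun_prop) (by fun_prop),
        integral_const_mul, e1]
      simp
    rw [hval] at h
    have e : (2 + η⁻¹) * η ^ 2 = 2 * η ^ 2 + η := by field_simp
    have h3 : (2 + η⁻¹) * (∫ ω, X ω ^ 2 ∂P - 2 * 1 + 1) ≤ (2 + η⁻¹) * η ^ 2 := by
      gcongr; linarith
    have h4 : 4 * η * (1 + ∫ ω, (X ω)⁻¹ ∂P) ≤ 4 * η * (1 + K) := by gcongr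
    linarith
  rw [abs_le]
  constructor <;> nlinarith [sq_nonneg η, mul_nonneg hη.le hK]

/-- The mean rate of a concentrated positive random variable. -/
theorem abs_integral_rate_sub_le {Y : Ω → ℝ} (hpos : ∀ᵐ ω ∂P, 0 < Y ω) (h1 : Integrable Y P)
    (h2 : Integrable (fun ω => Y ω ^ 2) P) (hi : Integrable (fun ω => (Y ω)⁻¹) P)
    {κ η K ρt : ℝ} (hκ : 0 < κ) (hη : 0 < η) (hρ : 0 < ρt) (e1 : ∫ ω, Y ω ∂P = κ)
    (e2 : ∫ ω, Y ω ^ 2 ∂P ≤ κ ^ 2 * (1 + η ^ 2)) (ei : ∫ ω, (Y ω)⁻¹ ∂P ≤ K / κ) :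
    Integrable (fun ω => rate ρt (Y ω)) P ∧
      |∫ ω, rate ρt (Y ω) ∂P - Real.logb 2 (ρt * κ ^ 2)|
        ≤ (1 / (ρt * κ ^ 2) + 4 * η ^ 2 + η * (10 + 8 * K)) / Real.log 2 := by
  have hlog2 : 0 < Real.log 2 := Real.log_pos (by norm_num)
  -- Normalise to mean 1: `1 + ρt Y² = ρt κ² (ε + (Y / κ)²)` with `ε = 1 / (ρt κ²)`.
  have hrate : ∀ ω, rate ρt (Y ω) = Real.logb 2 (ρt * κ ^ 2)
      + Real.log (1 / (ρt * κ ^ 2) + (κ⁻¹ * Y ω) ^ 2) / Real.log 2 := fun ω => by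
    rw [rate, Real.logb, Real.logb, ← add_div, ← Real.log_mul (by positivity) (by positivity)]
    congr 2
    field_simp
  obtain ⟨hint, hb⟩ := abs_integral_log_le (P := P) (X := fun ω => κ⁻¹ * Y ω) (η := η) (K := K)
    (ε := 1 / (ρt * κ ^ 2)) (by filter_upwards [hpos] with ω hω; positivity) (h1.const_mul _)
    (by simp only [mul_pow]; exact h2.const_mul _)
    (by simp only [mul_inv]; exact hi.const_mul _) hη
    (by rw [integral_const_mul, e1, inv_mul_cancel₀ hκ.ne'])
    (by
      simp only [mul_pow]
      rw [integral_const_mul, inv_pow, inv_mul_le_iff₀ (by positivity)]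
      exact e2)
    (by
      simp only [mul_inv, inv_inv]
      rw [integral_const_mul, mul_comm, ← le_div_iff₀ hκ]
      exact ei) (by positivity)
  refine ⟨?_, ?_⟩
  · simp only [hrate]
    exact (integrable_const _).add (hint.div_const _)
  · simp only [hrate]
    rw [integral_add (integrable_const _) (hint.div_const _), integral_div]
    simp only [integral_const, probReal_univ, smul_eq_mul, one_mul, add_sub_cancel_left]
    rw [abs_div, abs_of_pos hlog2]
    gcongr

end Concentration

end RIS

namespace RIS

/-! ### Moments of the closed-form density -/

section WithDensity

variable {f g : ℝ → ℝ}

lemma integrable_withDensity_ofReal_iff (hf : Measurable f) (h0 : ∀ x, 0 < x → 0 ≤ f x) :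
    Integrable g ((volume.restrict (Set.Ioi 0)).withDensity fun x => ENNReal.ofReal (f x)) ↔
      IntegrableOn (fun x => f x * g x) (Set.Ioi 0) := by
  rw [integrable_withDensity_iff_integrable_smul' hf.ennreal_ofReal (by simp)]
  refine integrableOn_congr_fun (fun x hx => ?_) measurableSet_Ioi
  simp only [smul_eq_mul]
  rw [ENNReal.toReal_ofReal (h0 x hx)]

lemma integral_withDensity_ofReal (hf : Measurable f) (h0 : ∀ x, 0 < x → 0 ≤ f x) :
    ∫ x, g x ∂((volume.restrict (Set.Ioi 0)).withDensity fun x => ENNReal.ofReal (f x)) =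
      ∫ x in Set.Ioi 0, f x * g x := by
  rw [integral_withDensity_eq_integral_toReal_smul hf.ennreal_ofReal (by simp)]
  refine setIntegral_congr_fun measurableSet_Ioi (fun x hx => ?_)
  simp only [smul_eq_mul]
  rw [ENNReal.toReal_ofReal (h0 x hx)]

lemma ae_pos_withDensity {F : ℝ → ENNReal} :
    ∀ᵐ x ∂((volume.restrict (Set.Ioi (0 : ℝ))).withDensity F), 0 < x :=
  (withDensity_absolutelyContinuous _ _).ae_le (ae_restrict_mem measurableSet_Ioi)

end WithDensity

/-- The law with density `fA N`. -/
noncomputable def closedFormLaw (N : ℕ) : Measure ℝ :=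
  (volume.restrict (Set.Ioi 0)).withDensity fun x => ENNReal.ofReal (fA N x)

lemma measurable_fA (N : ℕ) : Measurable (fA N) := by
  unfold fA
  fun_prop

lemma fA_nonneg {N : ℕ} (hN : 1 ≤ N) (x : ℝ) (hx : 0 < x) : 0 ≤ fA N x := by
  have hb := b_pos hN
  have ha := a_pos hN
  have hG : 0 < Real.Gamma (a N + 1) := Real.Gamma_pos_of_pos (by linarith)
  unfold fA
  positivity

lemma integral_fA_mul_rpow {N : ℕ} (hN : 1 ≤ N) {s : ℝ} (hs : 0 < a N + 1 + s) :
    IntegrableOn (fun x => fA N x * x ^ s) (Set.Ioi 0) ∧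
      ∫ x in Set.Ioi 0, fA N x * x ^ s
        = b N ^ s * Real.Gamma (a N + 1 + s) / Real.Gamma (a N + 1) := by
  have hb := b_pos hN
  have ha := a_pos hN
  have hG : 0 < Real.Gamma (a N + 1) := Real.Gamma_pos_of_pos (by linarith)
  have hG' : 0 < Real.Gamma (a N + 1 + s) := Real.Gamma_pos_of_pos hs
  have hval : ∫ x in Set.Ioi 0, fA N x * x ^ s
      = b N ^ s * Real.Gamma (a N + 1 + s) / Real.Gamma (a N + 1) := by
    have h := Real.integral_rpow_mul_exp_neg_mul_Ioi hs (inv_pos.2 hb)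
    have e : ∀ x ∈ Set.Ioi (0 : ℝ), fA N x * x ^ s
        = (b N ^ (a N + 1) * Real.Gamma (a N + 1))⁻¹
          * (x ^ (a N + 1 + s - 1) * Real.exp (-((b N)⁻¹ * x))) := fun x hx => by
      rw [fA, show a N + 1 + s - 1 = a N + s by ring, Real.rpow_add hx,
        show -x / b N = -((b N)⁻¹ * x) by field_simp]
      field_simp
    rw [setIntegral_congr_fun measurableSet_Ioi e, integral_const_mul, h, one_div, inv_inv,
      Real.rpow_add hb (a N + 1) s]
    have : 0 < b N ^ (a N + 1) := by positivity
    field_simp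
  -- A Bochner integral defaults to 0 without integrability, so the positive value proves
  -- integrability.
  refine ⟨Integrable.of_integral_ne_zero ?_, hval⟩
  rw [hval]
  positivity

lemma closedFormLaw_moments {N : ℕ} (hN : 1 ≤ N) :
    IsProbabilityMeasure (closedFormLaw N) ∧
    (Integrable (fun x => x) (closedFormLaw N) ∧ ∫ x, x ∂(closedFormLaw N) = k₁ N) ∧
    (Integrable (fun x => x ^ 2) (closedFormLaw N) ∧
      ∫ x, x ^ 2 ∂(closedFormLaw N) = k₁ N ^ 2 * (1 + 1 / (a N + 1))) ∧
    (Integrable (fun x => x⁻¹) (closedFormLaw N) ∧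
      ∫ x, x⁻¹ ∂(closedFormLaw N) = (1 + 1 / a N) / k₁ N) := by
  have hb := b_pos hN
  have ha := a_pos hN
  have hk := b_mul_a_add_one hN
  have hG : 0 < Real.Gamma (a N + 1) := Real.Gamma_pos_of_pos (by linarith)
  have hm := measurable_fA N
  have h0 := fA_nonneg hN
  have hcongr : ∀ {s : ℝ} {g : ℝ → ℝ}, (∀ x, 0 < x → x ^ s = g x) → 0 < a N + 1 + s →
      Integrable g (closedFormLaw N) ∧ ∫ x, g x ∂(closedFormLaw N)
        = b N ^ s * Real.Gamma (a N + 1 + s) / Real.Gamma (a N + 1) := by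
    intro s g hg hs
    obtain ⟨h₁, h₂⟩ := integral_fA_mul_rpow hN hs
    have e : ∀ x ∈ Set.Ioi (0 : ℝ), fA N x * x ^ s = fA N x * g x := fun x hx => by
      rw [hg x hx]
    rw [closedFormLaw, integrable_withDensity_ofReal_iff hm h0, integral_withDensity_ofReal hm h0]
    exact ⟨h₁.congr_fun e measurableSet_Ioi, by
      rw [← h₂]; exact (setIntegral_congr_fun measurableSet_Ioi e).symm⟩
  have m0 := hcongr (s := 0) (g := fun _ => 1) (by simp) (by linarith)
  have m1 := hcongr (s := 1) (g := fun x => x) (by simp) (by linarith)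
  have m2 := hcongr (s := 2) (g := fun x => x ^ 2) (by simp) (by linarith)
  have mi := hcongr (s := -1) (g := fun x => x⁻¹) (fun x hx => Real.rpow_neg_one x) (by linarith)
  have g1 : Real.Gamma (a N + 1 + 1) = (a N + 1) * Real.Gamma (a N + 1) :=
    Real.Gamma_add_one (by linarith)
  have g2 : Real.Gamma (a N + 1 + 2) = (a N + 1 + 1) * ((a N + 1) * Real.Gamma (a N + 1)) := by
    rw [← g1, ← Real.Gamma_add_one (by linarith)]
    congr 1; ring
  have gi : Real.Gamma (a N + 1) = a N * Real.Gamma (a N + 1 + -1) := by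
    rw [Real.Gamma_add_one ha.ne']
    congr 2; ring
  refine ⟨?_, ⟨m1.1, ?_⟩, ⟨m2.1, ?_⟩, ⟨mi.1, ?_⟩⟩
  · have h := m0.2
    rw [Real.rpow_zero, add_zero, one_mul, div_self hG.ne', integral_const, smul_eq_mul,
      mul_one] at h
    refine ⟨?_⟩
    rwa [measureReal_def, ENNReal.toReal_eq_one_iff] at h
  · rw [m1.2, g1, Real.rpow_one, ← hk]
    field_simp
  · rw [m2.2, g2, Real.rpow_two, ← hk]
    field_simp
  · rw [mi.2, Real.rpow_neg_one, ← hk]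
    have : Real.Gamma (a N + 1 + -1) ≠ 0 := by
      intro h
      rw [h, mul_zero] at gi
      exact hG.ne' gi
    rw [gi]
    field_simp

lemma k₁_sq_ge {N : ℕ} (hN : 1 ≤ N) : (N : ℝ) ≤ k₁ N ^ 2 := by
  have h := pi_sq_bounds.1
  have : (1 : ℝ) ≤ N := by exact_mod_cast hN
  rw [k₁]
  nlinarith [mul_pos (by linarith : (0 : ℝ) < N) (by linarith : (0 : ℝ) < N)]

/-- The rate bound for mean `k₁ N` and relative variance at most `1 / N`. -/
noncomputable def rateBound (N : ℕ) (ρt : ℝ) : ℝ :=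
  (1 / (ρt * k₁ N ^ 2) + 4 * (√N)⁻¹ ^ 2 + (√N)⁻¹ * (10 + 8 * 5)) / Real.log 2

theorem densityCapacity_sub_le {N : ℕ} (hN : 1 ≤ N) {ρt : ℝ} (hρ : 0 < ρt) :
    IntegrableOn (fun y => rate ρt y * fA N y) (Set.Ioi 0) ∧
      |densityCapacity N ρt - Real.logb 2 (ρt * k₁ N ^ 2)| ≤ rateBound N ρt := by
  obtain ⟨hP, ⟨i1, e1⟩, ⟨i2, e2⟩, ⟨ii, ei⟩⟩ := closedFormLaw_moments hN
  have hN' : (1 : ℝ) ≤ N := by exact_mod_cast hN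
  have hs := shape_bounds.1
  have ha := a_add_one hN
  have ha0 := a_pos hN
  have hk := k₁_pos hN
  have h := abs_integral_rate_sub_le (P := closedFormLaw N) (Y := fun x => x) (κ := k₁ N)
    (η := (√N)⁻¹) (K := 5) (ρt := ρt) ae_pos_withDensity i1 i2 ii hk (by positivity) hρ e1
    (by
      rw [e2, inv_pow, Real.sq_sqrt (by linarith), ha, ← one_div]
      gcongr
      nlinarith)
    (by
      rw [ei]
      gcongr
      -- Already at `N = 1`, `a ≥ 9/7 - 1 = 2/7`; hence `K = 5` serves for all `N`.
      have : 1 / a N ≤ 4 := by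
        rw [div_le_iff₀ ha0]
        nlinarith
      linarith)
  rw [closedFormLaw, integrable_withDensity_ofReal_iff (measurable_fA N) (fA_nonneg hN),
    integral_withDensity_ofReal (measurable_fA N) (fA_nonneg hN)] at h
  simp only [mul_comm (fA N _)] at h
  exact h

end RIS

namespace RIS

/-! ### Moments of the Rayleigh law -/

lemma rayleighMeasure_one : rayleighMeasure 1 =
    (volume.restrict (Set.Ioi 0)).withDensity
      fun x => ENNReal.ofReal (x * Real.exp (-x ^ 2 / 2)) := by
  rw [rayleighMeasure, ← withDensity_indicator measurableSet_Ioi]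
  congr 1
  ext x
  rw [Set.indicator_apply]
  by_cases hx : 0 < x
  · rw [if_pos hx.le, if_pos (show x ∈ Set.Ioi 0 from hx)]
    norm_num
  · rcases (not_lt.1 hx).lt_or_eq with h | h
    · rw [if_neg h.not_ge, ENNReal.ofReal_zero, if_neg (show x ∉ Set.Ioi 0 from hx)]
    · simp [h]

/-- The factor `x` in the density keeps powers down to `s > -2` integrable, including the inverse
moment `s = -1`. -/
lemma rayleighMeasure_rpow {s : ℝ} {g : ℝ → ℝ} (hg : ∀ x, 0 < x → x ^ s = g x) (hs : -2 < s) :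
    Integrable g (rayleighMeasure 1) ∧ ∫ x, g x ∂(rayleighMeasure 1)
      = (1 / 2) ^ (-(s + 2) / 2) * (1 / 2) * Real.Gamma ((s + 2) / 2) := by
  have hm : Measurable fun x : ℝ => x * Real.exp (-x ^ 2 / 2) := by fun_prop
  have h0 : ∀ x : ℝ, 0 < x → 0 ≤ x * Real.exp (-x ^ 2 / 2) := fun x hx => by positivity
  have h := integral_rpow_mul_exp_neg_mul_rpow (p := 2) (q := s + 1) (b := 1 / 2) two_pos
    (by linarith) (by norm_num)
  rw [show s + 1 + 1 = s + 2 by ring] at h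
  have e : ∀ x ∈ Set.Ioi (0 : ℝ), x ^ (s + 1) * Real.exp (-(1 / 2) * x ^ (2 : ℝ))
      = x * Real.exp (-x ^ 2 / 2) * g x := fun x hx => by
    rw [← hg x hx, Real.rpow_add_one (ne_of_gt hx), Real.rpow_two,
      show -(1 / 2) * x ^ 2 = -x ^ 2 / 2 by ring]
    ring
  have hG : 0 < Real.Gamma ((s + 2) / 2) := Real.Gamma_pos_of_pos (by linarith)
  rw [rayleighMeasure_one, integrable_withDensity_ofReal_iff hm h0,
    integral_withDensity_ofReal hm h0]
  have hi : IntegrableOn (fun x : ℝ => x ^ (s + 1) * Real.exp (-(1 / 2) * x ^ (2 : ℝ)))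
      (Set.Ioi 0) := Integrable.of_integral_ne_zero (by rw [h]; positivity)
  exact ⟨hi.congr_fun e measurableSet_Ioi, by
    rw [← h]; exact (setIntegral_congr_fun measurableSet_Ioi e).symm⟩

lemma rayleighMeasure_id :
    Integrable (fun x => x) (rayleighMeasure 1) ∧ ∫ x, x ∂(rayleighMeasure 1) = √(π / 2) := by
  obtain ⟨h₁, h₂⟩ := rayleighMeasure_rpow (s := 1) (g := fun x => x) (by simp) (by norm_num)
  refine ⟨h₁, h₂.trans ?_⟩
  rw [show ((1 : ℝ) + 2) / 2 = 1 / 2 + 1 by norm_num, Real.Gamma_add_one (by norm_num),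
    Real.Gamma_one_half_eq, show -((1 : ℝ) + 2) / 2 = -(1 + 1 / 2) by norm_num, Real.rpow_neg
    (by norm_num), Real.rpow_add (by norm_num), Real.rpow_one, ← Real.sqrt_eq_rpow,
    Real.sqrt_div Real.pi_nonneg, Real.sqrt_div zero_le_one, Real.sqrt_one]
  field_simp
  norm_num

lemma rayleighMeasure_inv :
    Integrable (fun x => x⁻¹) (rayleighMeasure 1) ∧
      ∫ x, x⁻¹ ∂(rayleighMeasure 1) = √(π / 2) := by
  obtain ⟨h₁, h₂⟩ := rayleighMeasure_rpow (s := -1) (g := fun x => x⁻¹)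
    (fun x _ => Real.rpow_neg_one x) (by norm_num)
  refine ⟨h₁, h₂.trans ?_⟩
  rw [show ((-1 : ℝ) + 2) / 2 = 1 / 2 by norm_num, Real.Gamma_one_half_eq,
    show -((-1 : ℝ) + 2) / 2 = -(1 / 2) by norm_num, Real.rpow_neg (by norm_num),
    ← Real.sqrt_eq_rpow, Real.sqrt_div Real.pi_nonneg, Real.sqrt_div zero_le_one, Real.sqrt_one]
  field_simp
  rw [Real.sq_sqrt (by norm_num)]

lemma rayleighMeasure_sq :
    Integrable (fun x => x ^ 2) (rayleighMeasure 1) ∧ ∫ x, x ^ 2 ∂(rayleighMeasure 1) = 2 := by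
  obtain ⟨h₁, h₂⟩ := rayleighMeasure_rpow (s := 2) (g := fun x => x ^ 2) (by simp) (by norm_num)
  refine ⟨h₁, h₂.trans ?_⟩
  rw [show ((2 : ℝ) + 2) / 2 = 2 by norm_num, Real.Gamma_two,
    show -((2 : ℝ) + 2) / 2 = -2 by norm_num, Real.rpow_neg (by norm_num), Real.rpow_two]
  norm_num

lemma ae_pos_rayleighMeasure : ∀ᵐ x ∂(rayleighMeasure 1), 0 < x := by
  rw [rayleighMeasure_one]
  exact ae_pos_withDensity

/-! ### Moments of the end-to-end channel -/

section Channel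

variable {Ω : Type*} [MeasurableSpace Ω] {μ : Measure Ω}

lemma hasLaw_integrable_comp {X : Ω → ℝ} {ν : Measure ℝ} (hX : HasLaw X ν μ) {f : ℝ → ℝ}
    (hf : Integrable f ν) :
    Integrable (fun ω => f (X ω)) μ ∧ ∫ ω, f (X ω) ∂μ = ∫ x, f x ∂ν := by
  refine ⟨?_, hX.integral_comp hf.aestronglyMeasurable⟩
  rw [← hX.map_eq] at hf
  exact hf.comp_aemeasurable hX.aemeasurable

lemma integrable_integral_mul {X Y : Ω → ℝ} (hX : HasLaw X (rayleighMeasure 1) μ)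
    (hY : HasLaw Y (rayleighMeasure 1) μ) (hXY : IndepFun X Y μ) {f : ℝ → ℝ} (hm : Measurable f)
    (hf : Integrable f (rayleighMeasure 1)) :
    Integrable (fun ω => f (X ω) * f (Y ω)) μ ∧
      ∫ ω, f (X ω) * f (Y ω) ∂μ = (∫ x, f x ∂(rayleighMeasure 1)) ^ 2 := by
  obtain ⟨i₁, e₁⟩ := hasLaw_integrable_comp hX hf
  obtain ⟨i₂, e₂⟩ := hasLaw_integrable_comp hY hf
  have hind : IndepFun (fun ω => f (X ω)) (fun ω => f (Y ω)) μ := hXY.comp hm hm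
  refine ⟨hind.integrable_mul i₁ i₂, ?_⟩
  rw [hind.integral_fun_mul_eq_mul_integral i₁.aestronglyMeasurable i₂.aestronglyMeasurable, e₁, e₂,
    sq]

variable {N : ℕ} {h g : Fin N → Ω → ℂ}

lemma IsRayleighChannel.iIndepFun_norm (hc : IsRayleighChannel μ h g) :
    iIndepFun (fun j ω => ‖(Sum.elim h g j : Ω → ℂ) ω‖) μ :=
  hc.indep.comp (fun _ z => ‖z‖) fun _ => measurable_norm

lemma IsRayleighChannel.law (hc : IsRayleighChannel μ h g) (j : Fin N ⊕ Fin N) :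
    HasLaw (fun ω => ‖(Sum.elim h g j : Ω → ℂ) ω‖) (rayleighMeasure 1) μ := by
  rcases j with i | i
  · exact hc.law_h i
  · exact hc.law_g i

lemma IsRayleighChannel.indepFun_unit (hc : IsRayleighChannel μ h g) (i : Fin N) :
    IndepFun (fun ω => ‖h i ω‖) (fun ω => ‖g i ω‖) μ :=
  hc.iIndepFun_norm.indepFun (i := Sum.inl i) (j := Sum.inr i) (by simp)

lemma IsRayleighChannel.indepFun_units (hc : IsRayleighChannel μ h g) {i j : Fin N} (hij : i ≠ j) :
    IndepFun (fun ω => ‖h i ω‖ * ‖g i ω‖) (fun ω => ‖h j ω‖ * ‖g j ω‖) μ :=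
  hc.iIndepFun_norm.indepFun_mul_mul₀ (fun j => (hc.law j).aemeasurable)
    (Sum.inl i) (Sum.inr i) (Sum.inl j) (Sum.inr j) (by simpa) (by simp) (by simp) (by simpa)

lemma IsRayleighChannel.unit_moments (hc : IsRayleighChannel μ h g) (i : Fin N) :
    (∀ᵐ ω ∂μ, 0 < ‖h i ω‖ * ‖g i ω‖) ∧
    (Integrable (fun ω => ‖h i ω‖ * ‖g i ω‖) μ ∧ ∫ ω, ‖h i ω‖ * ‖g i ω‖ ∂μ = π / 2) ∧
    (Integrable (fun ω => (‖h i ω‖ * ‖g i ω‖) ^ 2) μ ∧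
      ∫ ω, (‖h i ω‖ * ‖g i ω‖) ^ 2 ∂μ = 4) ∧
    (Integrable (fun ω => (‖h i ω‖ * ‖g i ω‖)⁻¹) μ ∧
      ∫ ω, (‖h i ω‖ * ‖g i ω‖)⁻¹ ∂μ = π / 2) := by
  have hpi : √(π / 2) ^ 2 = π / 2 := Real.sq_sqrt (by positivity)
  have hind := hc.indepFun_unit i
  refine ⟨?_, ?_, ?_, ?_⟩
  · have h₁ := ((hc.law_h i).ae_iff (p := fun x => 0 < x)
      (measurableSet_setOfPred.1 measurableSet_Ioi)).2 ae_pos_rayleighMeasure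
    have h₂ := ((hc.law_g i).ae_iff (p := fun x => 0 < x)
      (measurableSet_setOfPred.1 measurableSet_Ioi)).2 ae_pos_rayleighMeasure
    filter_upwards [h₁, h₂] with ω h₁ h₂ using mul_pos h₁ h₂
  · have := integrable_integral_mul (hc.law_h i) (hc.law_g i) hind measurable_id
      rayleighMeasure_id.1
    simp only [id] at this
    rwa [rayleighMeasure_id.2, hpi] at this
  · have := integrable_integral_mul (hc.law_h i) (hc.law_g i) hind (f := fun x => x ^ 2)
      (by fun_prop) rayleighMeasure_sq.1
    simp only [← mul_pow] at this
    rw [rayleighMeasure_sq.2] at this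
    norm_num at this ⊢
    exact this
  · have := integrable_integral_mul (hc.law_h i) (hc.law_g i) hind (f := fun x => x⁻¹)
      (by fun_prop) rayleighMeasure_inv.1
    simp only [← mul_inv] at this
    rwa [rayleighMeasure_inv.2, hpi] at this

/-- Cauchy–Schwarz applied to `1 = z i * (z i)⁻¹`, that is, the harmonic–arithmetic mean inequality.
-/
lemma inv_sum_le {ι : Type*} [Fintype ι] [Nonempty ι] {z : ι → ℝ} (hz : ∀ i, 0 < z i) :
    (∑ i, z i)⁻¹ ≤ (Fintype.card ι : ℝ)⁻¹ ^ 2 * ∑ i, (z i)⁻¹ := by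
  have hc : (0 : ℝ) < Fintype.card ι := by exact_mod_cast Fintype.card_pos
  have hS : 0 < ∑ i, z i := Finset.sum_pos (fun i _ => hz i) Finset.univ_nonempty
  have h := Finset.sum_sq_le_sum_mul_sum_of_sq_le_mul Finset.univ (r := fun _ => (1 : ℝ))
    (f := fun i => z i) (g := fun i => (z i)⁻¹) (fun i _ => (hz i).le)
    (fun i _ => (inv_pos.2 (hz i)).le) (fun i _ => le_of_eq <| by rw [mul_inv_cancel₀ (hz i).ne', one_pow])
  simp only [Finset.sum_const, Finset.card_univ, nsmul_eq_mul, mul_one] at h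
  rw [inv_pow, ← div_eq_inv_mul, le_div_iff₀ (by positivity), inv_mul_le_iff₀ hS]
  exact h

variable [IsProbabilityMeasure μ]

theorem IsRayleighChannel.ergodicCapacity_sub_le (hc : IsRayleighChannel μ h g) (hN : 1 ≤ N)
    {ρt : ℝ} (hρ : 0 < ρt) :
    Integrable (fun ω => rate ρt (A (fun i => h i ω) (fun i => g i ω))) μ ∧
      |ergodicCapacity μ h g ρt - Real.logb 2 (ρt * k₁ N ^ 2)| ≤ rateBound N ρt := by
  have hN' : (1 : ℝ) ≤ N := by exact_mod_cast hN
  have : Nonempty (Fin N) := ⟨⟨0, hN⟩⟩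
  have hk := k₁_pos hN
  have hpi := pi_sq_bounds
  let Z : Fin N → Ω → ℝ := fun i ω => ‖h i ω‖ * ‖g i ω‖
  have hZpos : ∀ᵐ ω ∂μ, ∀ i, 0 < Z i ω := ae_all_iff.2 fun i => (hc.unit_moments i).1
  have hZ1 : ∀ i, Integrable (Z i) μ := fun i => (hc.unit_moments i).2.1.1
  have hZ2 : ∀ i, MemLp (Z i) 2 μ := fun i =>
    (memLp_two_iff_integrable_sq (hZ1 i).aestronglyMeasurable).2 (hc.unit_moments i).2.2.1.1
  have hZi : ∀ i, Integrable (fun ω => (Z i ω)⁻¹) μ := fun i => (hc.unit_moments i).2.2.2.1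
  have hAsum : (fun ω => A (fun i => h i ω) (fun i => g i ω)) = ∑ i, Z i := by
    ext ω
    simp [A, Z]
  have hA2 : MemLp (∑ i, Z i) 2 μ := memLp_finsetSum' _ fun i _ => hZ2 i
  have hA1 : Integrable (∑ i, Z i) μ := hA2.integrable (by norm_num)
  have hpos : ∀ᵐ ω ∂μ, 0 < (∑ i, Z i) ω := by
    filter_upwards [hZpos] with ω hω
    rw [Finset.sum_apply]
    exact Finset.sum_pos (fun i _ => hω i) Finset.univ_nonempty
  have e1 : ∫ ω, (∑ i, Z i) ω ∂μ = k₁ N := by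
    simp only [Finset.sum_apply]
    rw [integral_finsetSum _ fun i _ => hZ1 i,
      Finset.sum_congr rfl fun i _ => (hc.unit_moments i).2.1.2]
    simp [k₁, mul_div_assoc]
  have hvar : Var[∑ i, Z i; μ] = N * (4 - (π / 2) ^ 2) := by
    rw [IndepFun.variance_sum (fun i _ => hZ2 i) fun i _ j _ hij => hc.indepFun_units hij,
      Finset.sum_congr rfl fun i _ => show Var[Z i; μ] = 4 - (π / 2) ^ 2 from ?_]
    · rw [Finset.sum_const, Finset.card_univ, Fintype.card_fin, nsmul_eq_mul]
    · rw [variance_eq_sub (hZ2 i)]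
      have h₁ : ∫ ω, Z i ω ∂μ = π / 2 := (hc.unit_moments i).2.1.2
      have h₂ : ∫ ω, (Z i ^ 2) ω ∂μ = 4 := (hc.unit_moments i).2.2.1.2
      rw [h₁, h₂]
  have e2 : ∫ ω, (∑ i, Z i) ω ^ 2 ∂μ = k₁ N ^ 2 + N * (4 - (π / 2) ^ 2) := by
    have h₁ := variance_eq_sub hA2
    have h₂ : ∫ ω, ((∑ i, Z i) ^ 2) ω ∂μ = ∫ ω, (∑ i, Z i) ω ^ 2 ∂μ := rfl
    rw [hvar, h₂, e1] at h₁
    linarith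
  have hle : ∀ᵐ ω ∂μ, ((∑ i, Z i) ω)⁻¹ ≤ (N : ℝ)⁻¹ ^ 2 * ∑ i, (Z i ω)⁻¹ := by
    filter_upwards [hZpos] with ω hω
    have := inv_sum_le hω
    rwa [Fintype.card_fin, ← Finset.sum_apply] at this
  have hmaj : Integrable (fun ω => (N : ℝ)⁻¹ ^ 2 * ∑ i, (Z i ω)⁻¹) μ :=
    (integrable_finsetSum _ fun i _ => hZi i).const_mul _
  have hAi : Integrable (fun ω => ((∑ i, Z i) ω)⁻¹) μ := by
    refine Integrable.mono' hmaj hA1.aestronglyMeasurable.aemeasurable.inv.aestronglyMeasurable ?_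
    filter_upwards [hle, hpos] with ω hω hp
    rwa [Real.norm_eq_abs, abs_of_pos (inv_pos.2 hp)]
  have ei : ∫ ω, ((∑ i, Z i) ω)⁻¹ ∂μ ≤ 5 / k₁ N := by
    refine (integral_mono_ae hAi hmaj hle).trans ?_
    rw [integral_const_mul, integral_finsetSum _ fun i _ => hZi i,
      Finset.sum_congr rfl fun i _ => (hc.unit_moments i).2.2.2.2]
    simp only [Finset.sum_const, Finset.card_univ, Fintype.card_fin, nsmul_eq_mul]
    rw [le_div_iff₀ hk, k₁]
    have : (N : ℝ)⁻¹ ^ 2 * (N * (π / 2)) * (N * π / 2) = π ^ 2 / 4 := by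
      field_simp
      norm_num
    linarith
  have key := abs_integral_rate_sub_le hpos hA1 hA2.integrable_sq hAi (η := (√N)⁻¹) hk
    (by positivity) hρ e1
    (by
      rw [e2, inv_pow, Real.sq_sqrt (by linarith)]
      -- The variance bound thus reduces to `4 - π² / 4 ≤ π² / 4`, that is, `8 ≤ π²`.
      have : k₁ N ^ 2 * (1 + (N : ℝ)⁻¹) = k₁ N ^ 2 + N * (π / 2) ^ 2 := by
        rw [k₁]
        field_simp
      rw [this]
      gcongr
      linarith) ei
  rw [← hAsum] at key
  exact key

end Channel

end RIS

namespace RIS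

/-! ### The digamma function -/

/-- `log Γ` is convex, and by the functional equation its chords over `[x, x + 1]` and `[x + 1, x +
2]` have slopes `log x` and `log (x + 1)`; these enclose the derivative at `x + 1`. -/
lemma digamma_bounds {x : ℝ} (hx : 0 < x) :
    Real.log x ≤ digamma (x + 1) ∧ digamma (x + 1) ≤ Real.log (x + 1) := by
  have hG : ∀ {y : ℝ}, 0 < y → 0 < Real.Gamma y := Real.Gamma_pos_of_pos
  have hlog : ∀ {y : ℝ}, 0 < y →
      Real.log (Real.Gamma (y + 1)) = Real.log y + Real.log (Real.Gamma y) := fun hy => by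
    rw [Real.Gamma_add_one hy.ne', Real.log_mul hy.ne' (hG hy).ne']
  have hd : HasDerivAt (Real.log ∘ Real.Gamma) (digamma (x + 1)) (x + 1) := by
    have hne : ∀ m : ℕ, x + 1 ≠ -m := fun m => by
      have : (0 : ℝ) ≤ m := m.cast_nonneg
      linarith
    exact (Real.differentiableAt_Gamma hne).hasDerivAt.log (hG (by linarith)).ne'
  have h₁ := Real.convexOn_log_Gamma.slope_le_of_hasDerivAt (x := x) (y := x + 1)
    hx (by linarith : 0 < x + 1) (by linarith) hd
  have h₂ := Real.convexOn_log_Gamma.le_slope_of_hasDerivAt (x := x + 1) (y := x + 1 + 1)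
    (by linarith : 0 < x + 1) (by linarith : 0 < x + 1 + 1) (by linarith) hd
  rw [slope_def_field] at h₁ h₂
  simp only [Function.comp_apply, add_sub_cancel_left, div_one] at h₁ h₂
  rw [hlog hx] at h₁
  rw [hlog (by linarith : 0 < x + 1)] at h₂
  exact ⟨by linarith, by linarith⟩

/-! ### The cosecant and secant terms -/

lemma sin_shape_eq {N : ℕ} (hN : 1 ≤ N) :
    |Real.sin (shape * N * π)| = 2 * |Real.sin (a N * π / 2)| * |Real.cos (a N * π / 2)| := by
  have h := Real.sin_two_mul (a N * π / 2)
  rw [mul_div_cancel₀ _ two_ne_zero] at h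
  rw [← a_add_one hN, add_mul, one_mul, Real.sin_add_pi, abs_neg, h, abs_mul, abs_mul, abs_two]

lemma abs_sin_shape_le {N : ℕ} (hN : 1 ≤ N) :
    |Real.sin (shape * N * π)| ≤ 2 * |Real.sin (a N * π / 2)| ∧
      |Real.sin (shape * N * π)| ≤ 2 * |Real.cos (a N * π / 2)| := by
  rw [sin_shape_eq hN]
  constructor
  · exact mul_le_of_le_one_right (by positivity) (Real.abs_cos_le_one _)
  · rw [mul_right_comm]
    exact mul_le_of_le_one_right (by positivity) (Real.abs_sin_le_one _)

lemma poch_eq (N : ℕ) : poch (a N - 1) 2 = (a N - 1) * a N := by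
  simp [poch, ascPochhammer_succ_right]

lemma wellDefined {N : ℕ} (hN : 1 ≤ N) :
    Real.sin (a N * π / 2) ≠ 0 ∧ Real.cos (a N * π / 2) ≠ 0 ∧ poch (a N - 1) 2 ≠ 0 := by
  have h := sin_shape_mul_ne_zero hN
  have h' := sin_shape_eq hN
  refine ⟨fun h0 => h ?_, fun h0 => h ?_, ?_⟩
  · rw [h0] at h'
    simpa using h'
  · rw [h0] at h'
    simpa using h'
  · rw [poch_eq]
    -- `a N = 1` would make `shape * N` the integer 2.
    refine mul_ne_zero (fun h0 => h ?_) (a_pos hN).ne'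
    rw [← a_add_one hN, show a N + 1 = 2 by linarith]
    exact Real.sin_two_pi

/-- A lower bound for powers that is uniform in base and exponent. -/
lemma one_le_pow_mul_rpow {y₀ y e : ℝ} {N : ℕ} (hy₀ : 0 < y₀) (hy : y₀ ≤ y) (he : 0 ≤ e)
    (heN : e ≤ 3 * N) : 1 ≤ ((max 1 y₀⁻¹) ^ 3) ^ N * y ^ e := by
  set M := max 1 y₀⁻¹
  have hM : 1 ≤ M := le_max_left _ _
  have hM' : y₀⁻¹ ≤ M := le_max_right _ _
  have h₁ : M ^ e ≤ (M ^ 3) ^ N := by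
    rw [← pow_mul, ← Real.rpow_natCast]
    exact Real.rpow_le_rpow_of_exponent_le hM (by push_cast; linarith)
  have h₂ : (y₀⁻¹) ^ e ≤ M ^ e := Real.rpow_le_rpow (by positivity) hM' he
  have h₃ : y₀ ^ e ≤ y ^ e := Real.rpow_le_rpow hy₀.le hy he
  calc (1 : ℝ) = (y₀⁻¹) ^ e * y₀ ^ e := by
        rw [← Real.mul_rpow (by positivity) hy₀.le, inv_mul_cancel₀ hy₀.ne', Real.one_rpow]
    _ ≤ _ := mul_le_mul (h₂.trans h₁) h₃ (by positivity) (by positivity)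

/-- Common shape of both terms: `t` is the sine or cosine, `s` the sine of the doubled angle, and
`K₁`, `K₂` compensate powers of `b` and `ρt` that may be below 1. -/
lemma abs_term_le {t s L c B G R K₁ K₂ : ℝ} (hs : 0 < s) (ht : s ≤ 2 * |t|) (hL : 0 < L)
    (hc : 1 ≤ c) (hB : 0 < B) (hG : 0 < G) (hR : 0 < R) (h₁ : 1 ≤ K₁ * B) (h₂ : 1 ≤ K₂ * R) :
    |π * (1 / t) / (L * c * B * G * R)| ≤ 2 * π / L * (K₁ * K₂ / (s * G)) := by
  have ht0 : 0 < |t| := by linarith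
  have hK : 1 ≤ (K₁ * B) * (K₂ * R) := one_le_mul_of_one_le_of_one_le h₁ h₂
  have e : |π * (1 / t) / (L * c * B * G * R)| = π / (|t| * (L * c * B * G * R)) := by
    rw [abs_div, abs_mul, abs_div, abs_one, abs_of_pos Real.pi_pos,
      abs_of_pos (by positivity : 0 < L * c * B * G * R)]
    field_simp
  rw [e]
  calc π / (|t| * (L * c * B * G * R)) ≤ π / (s / 2 * (L * 1 * B * G * R)) := by
        gcongr; linarith
    _ = 2 * π / L * (1 / (B * R) / (s * G)) := by field_simp
    _ ≤ _ := by
        gcongr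
        rw [div_le_iff₀ (by positivity)]
        linarith

/-- A bound for the cosecant and the secant term. -/
noncomputable def trigBound (ρ₀ : ℝ) (N : ℕ) : ℝ :=
  2 * π / Real.log 2 *
    (((max 1 ((16 - π ^ 2) / (2 * π))⁻¹) ^ 3 * (max 1 ρ₀⁻¹) ^ 3) ^ N
      / (|Real.sin (shape * N * π)| * Real.Gamma (shape * N)))

lemma tendsto_trigBound (ρ₀ : ℝ) : Tendsto (trigBound ρ₀) atTop (𝓝 0) := by
  have h := (tendsto_pow_div_sin_mul_Gamma
    ((max 1 ((16 - π ^ 2) / (2 * π))⁻¹) ^ 3 * (max 1 ρ₀⁻¹) ^ 3)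
    (one_le_mul_of_one_le_of_one_le (one_le_pow₀ (le_max_left _ _))
      (one_le_pow₀ (le_max_left _ _)))).const_mul (2 * π / Real.log 2)
  rwa [mul_zero] at h

lemma abs_trigTerms_le {N : ℕ} (hN : 1 ≤ N) {ρ₀ ρt : ℝ} (hρ₀ : 0 < ρ₀) (hρ : ρ₀ ≤ ρt) :
    |cscTerm N ρt| ≤ trigBound ρ₀ N ∧ |secTerm N ρt| ≤ trigBound ρ₀ N := by
  have hN' : (1 : ℝ) ≤ N := by exact_mod_cast hN
  have hs : 0 < |Real.sin (shape * N * π)| := abs_pos.2 (sin_shape_mul_ne_zero hN)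
  have hL : 0 < Real.log 2 := Real.log_pos (by norm_num)
  have hb := b_pos hN
  have ha := a_pos hN
  have ha1 : a N + 1 ≤ 5 / 3 * N := by
    rw [a_add_one hN]
    exact mul_le_mul_of_nonneg_right shape_bounds.2.le (by linarith)
  have hG : 0 < Real.Gamma (a N + 1) := Real.Gamma_pos_of_pos (by linarith)
  have hρ' : 0 < ρt := hρ₀.trans_le hρ
  obtain ⟨h₁, h₂⟩ := abs_sin_shape_le hN
  have hE : 2 * π / Real.log 2 * (((max 1 (b N)⁻¹) ^ 3) ^ N * ((max 1 ρ₀⁻¹) ^ 3) ^ N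
      / (|Real.sin (shape * N * π)| * Real.Gamma (a N + 1))) = trigBound ρ₀ N := by
    rw [trigBound, a_add_one hN, b_eq hN, mul_pow]
  constructor
  · have h := abs_term_le hs h₁ hL (by linarith : 1 ≤ 2 + a N)
      (by positivity : 0 < b N ^ (a N + 2)) hG (by positivity : 0 < ρt ^ (a N / 2 + 1))
      (one_le_pow_mul_rpow (N := N) hb le_rfl (by linarith) (by linarith))
      (one_le_pow_mul_rpow (N := N) hρ₀ hρ (by linarith) (by linarith))
    rw [hE] at h
    exact h
  · have h := abs_term_le hs h₂ hL (by linarith : 1 ≤ a N + 1)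
      (by positivity : 0 < b N ^ (a N + 1)) hG (by positivity : 0 < ρt ^ ((a N + 1) / 2))
      (one_le_pow_mul_rpow (N := N) hb le_rfl (by linarith) (by linarith))
      (one_le_pow_mul_rpow (N := N) hρ₀ hρ (by linarith) (by linarith))
    rw [hE] at h
    rw [secTerm, sec]
    convert h using 3
    ring

/-! ### The high-`N` approximation -/

/-- A bound for the distance of the high-`N` approximation from `log₂ (ρt k₁²)`. -/
noncomputable def approxBound (ρ₀ : ℝ) (N : ℕ) : ℝ :=
  (1 / ((a N - 1) * (((16 - π ^ 2) / (2 * π)) ^ 2 * ρ₀)) + 4 / (a N + 1)) / Real.log 2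

lemma tendsto_a : Tendsto a atTop atTop := by
  have h : Tendsto (fun N : ℕ => shape * N - 1) atTop atTop :=
    tendsto_atTop_add_const_right _ _
      (tendsto_natCast_atTop_atTop.const_mul_atTop (by linarith [shape_bounds.1]))
  refine h.congr' ?_
  filter_upwards [eventually_ge_atTop 1] with N hN
  rw [← a_add_one hN, add_sub_cancel_right]

lemma tendsto_approxBound {ρ₀ : ℝ} (hρ₀ : 0 < ρ₀) : Tendsto (approxBound ρ₀) atTop (𝓝 0) := by
  have hp : 0 < 16 - π ^ 2 := by linarith [pi_sq_bounds.2]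
  have h₁ : Tendsto (fun N => 1 / ((a N - 1) * (((16 - π ^ 2) / (2 * π)) ^ 2 * ρ₀))) atTop
      (𝓝 0) :=
    ((tendsto_atTop_add_const_right _ (-1) tendsto_a).atTop_mul_const (by positivity)).const_div_atTop 1
  have h₂ : Tendsto (fun N => 4 / (a N + 1)) atTop (𝓝 0) :=
    (tendsto_atTop_add_const_right _ 1 tendsto_a).const_div_atTop 4
  have h := (h₁.add h₂).div_const (Real.log 2)
  rwa [add_zero, zero_div] at h

lemma abs_highSNRHighN_sub_le {N : ℕ} (hN : 2 ≤ N) {ρ₀ ρt : ℝ} (hρ₀ : 0 < ρ₀) (hρ : ρ₀ ≤ ρt) :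
    |highSNRHighN N ρt - Real.logb 2 (ρt * k₁ N ^ 2)| ≤ approxBound ρ₀ N := by
  have hN1 : 1 ≤ N := by omega
  have hN' : (2 : ℝ) ≤ N := by exact_mod_cast hN
  have hL : 0 < Real.log 2 := Real.log_pos (by norm_num)
  have hb := b_pos hN1
  have ha : 1 < a N := by
    have := a_add_one hN1
    nlinarith [shape_bounds.1]
  have hρ' : 0 < ρt := hρ₀.trans_le hρ
  have hk := b_mul_a_add_one hN1
  have hpoch : poch (a N - 1) 2 = a N ^ 2 - a N := by rw [poch_eq]; ring
  have hp0 : a N ^ 2 - a N ≠ 0 := by nlinarith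
  obtain ⟨hd₁, hd₂⟩ := digamma_bounds (x := a N + 2) (by linarith)
  rw [show a N + 2 + 1 = 3 + a N by ring] at hd₁ hd₂
  have hlog₁ : Real.log (a N + 1) ≤ Real.log (a N + 2) :=
    Real.log_le_log (by linarith) (by linarith)
  have hlog₂ : Real.log (3 + a N) - Real.log (a N + 1) ≤ 2 / (a N + 1) := by
    rw [← Real.log_div (by linarith) (by linarith)]
    refine (Real.log_le_sub_one_of_pos (by apply div_pos <;> linarith)).trans (le_of_eq ?_)
    have : a N + 1 ≠ 0 := by linarith
    field_simp
    ring
  have e : highSNRHighN N ρt - Real.logb 2 (ρt * k₁ N ^ 2)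
      = (1 / ((a N - 1) * a N * (b N ^ 2 * ρt))
        + 2 * (digamma (3 + a N) - Real.log (a N + 1))) / Real.log 2 := by
    have hlog : Real.logb 2 (ρt * k₁ N ^ 2)
        = Real.logb 2 (b N ^ 2 * ρt) + 2 * Real.log (a N + 1) / Real.log 2 := by
      rw [← hk, Real.logb, Real.logb, ← add_div,
        show ρt * (b N * (a N + 1)) ^ 2 = (b N ^ 2 * ρt) * (a N + 1) ^ 2 by ring,
        Real.log_mul (by positivity) (by positivity), Real.log_pow]
      norm_num
    rw [highSNRHighN, hpoch, div_self hp0, hlog, show (a N - 1) * a N = a N ^ 2 - a N by ring]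
    generalize a N ^ 2 - a N = D at hp0 ⊢
    field_simp
    ring
  have h₁ : 1 / ((a N - 1) * a N * (b N ^ 2 * ρt)) ≤ 1 / ((a N - 1) * (b N ^ 2 * ρ₀)) := by
    have ha' : 0 < a N - 1 := by linarith
    gcongr
    nlinarith
  have h₀ : 0 ≤ 1 / ((a N - 1) * a N * (b N ^ 2 * ρt)) := by
    have ha' : 0 < a N - 1 := by linarith
    positivity
  have h₂ : 2 * (2 / (a N + 1)) = 4 / (a N + 1) := by ring
  rw [e, approxBound, ← b_eq hN1, abs_of_nonneg (div_nonneg (by linarith) hL.le)]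
  gcongr
  linarith

lemma rateBound_le {N : ℕ} (hN : 1 ≤ N) {ρ₀ ρt : ℝ} (hρ₀ : 0 < ρ₀) (hρ : ρ₀ ≤ ρt) :
    rateBound N ρt ≤ rateBound N ρ₀ := by
  have hL : 0 < Real.log 2 := Real.log_pos (by norm_num)
  have hk := k₁_pos hN
  unfold rateBound
  gcongr

lemma tendsto_rateBound {ρ₀ : ℝ} (hρ₀ : 0 < ρ₀) :
    Tendsto (fun N => rateBound N ρ₀) atTop (𝓝 0) := by
  have hk : Tendsto (fun N => k₁ N ^ 2) atTop atTop := by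
    refine tendsto_atTop_mono' atTop ?_ tendsto_natCast_atTop_atTop
    filter_upwards [eventually_ge_atTop 1] with N hN using k₁_sq_ge hN
  have h₁ : Tendsto (fun N => 1 / (ρ₀ * k₁ N ^ 2)) atTop (𝓝 0) :=
    (hk.const_mul_atTop hρ₀).const_div_atTop 1
  have h₂ : Tendsto (fun N : ℕ => (√(N : ℝ))⁻¹) atTop (𝓝 0) :=
    (Real.tendsto_sqrt_atTop.comp tendsto_natCast_atTop_atTop).inv_tendsto_atTop
  have h := ((h₁.add ((h₂.pow 2).const_mul 4)).add (h₂.mul_const (10 + 8 * 5))).div_const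
    (Real.log 2)
  norm_num at h
  unfold rateBound
  norm_num
  exact h

lemma tendstoUniformlyOn_zero_of_abs_le {F : ℕ → ℝ → ℝ} {B : ℕ → ℝ} {s : Set ℝ}
    (hB : Tendsto B atTop (𝓝 0)) (h : ∀ᶠ N in atTop, ∀ x ∈ s, |F N x| ≤ B N) :
    TendstoUniformlyOn F (fun _ => 0) atTop s := by
  rw [Metric.tendstoUniformlyOn_iff]
  intro ε hε
  filter_upwards [h, hB.eventually_lt_const hε] with N hN hlt x hx
  rw [dist_zero_left, Real.norm_eq_abs]
  exact (hN x hx).trans_lt hlt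

end RIS

theorem corollary2
    -- for every number `N` of reflection units, a surface-assisted Rayleigh system
    (Ω : ℕ → Type*) [∀ N, MeasurableSpace (Ω N)]
    (μ : ∀ N, Measure (Ω N)) [∀ N, IsProbabilityMeasure (μ N)]
    (h g : ∀ N, Fin N → Ω N → ℂ)
    (hch : ∀ N, RIS.IsRayleighChannel (μ N) (h N) (g N)) :
    -- all expressions are well defined
    (∀ N : ℕ, 1 ≤ N →
      Real.sin (RIS.a N * π / 2) ≠ 0 ∧ Real.cos (RIS.a N * π / 2) ≠ 0 ∧
      RIS.poch (RIS.a N - 1) 2 ≠ 0) ∧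
    (∀ N : ℕ, 1 ≤ N → ∀ ρt : ℝ, 0 < ρt →
      Integrable (fun ω => RIS.rate ρt (RIS.A (fun i => h N i ω) (fun i => g N i ω))) (μ N) ∧
      IntegrableOn (fun y => RIS.rate ρt y * RIS.fA N y) (Set.Ioi 0)) ∧
    -- `1 / Γ(a + 1)` vanishes as `N → ∞`
    Tendsto (fun N => 1 / Real.Gamma (RIS.a N + 1)) atTop (𝓝 0) ∧
    -- all limits `N → ∞` below are uniform in `ρt ≥ ρ₀`, hence also joint in `N, ρt → ∞`
    ∀ ρ₀ : ℝ, 0 < ρ₀ →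
      -- the cosecant and the secant terms vanish
      TendstoUniformlyOn RIS.cscTerm (fun _ => 0) atTop (Set.Ici ρ₀) ∧
      TendstoUniformlyOn RIS.secTerm (fun _ => 0) atTop (Set.Ici ρ₀) ∧
      TendstoUniformlyOn (fun N ρt => RIS.highSNR N ρt - RIS.highSNRHighN N ρt)
        (fun _ => 0) atTop (Set.Ici ρ₀) ∧
      -- the ergodic capacity is approximated, both for the exact law of the end-to-end channel
      -- and for its closed-form density
      TendstoUniformlyOn
        (fun N ρt => RIS.ergodicCapacity (μ N) (h N) (g N) ρt - RIS.highSNRHighN N ρt)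
        (fun _ => 0) atTop (Set.Ici ρ₀) ∧
      TendstoUniformlyOn (fun N ρt => RIS.densityCapacity N ρt - RIS.highSNRHighN N ρt)
        (fun _ => 0) atTop (Set.Ici ρ₀) := by
  refine ⟨fun N hN => RIS.wellDefined hN, fun N hN ρt hρ =>
    ⟨((hch N).ergodicCapacity_sub_le hN hρ).1, (RIS.densityCapacity_sub_le hN hρ).1⟩, ?_, ?_⟩
  · refine Tendsto.congr' ?_ (RIS.tendsto_Gamma_shape_mul.const_div_atTop 1)
    filter_upwards [eventually_ge_atTop 1] with N hN
    rw [RIS.a_add_one hN]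
  intro ρ₀ hρ₀
  have htrig := RIS.tendsto_trigBound ρ₀
  have hcap := (RIS.tendsto_rateBound hρ₀).add (RIS.tendsto_approxBound hρ₀)
  rw [add_zero] at hcap
  -- Each capacity is compared with `highSNRHighN` through `L = log₂ (ρt k₁²)`.
  have key : ∀ {C L H r₁ r₂ : ℝ}, |C - L| ≤ r₁ → |H - L| ≤ r₂ → |C - H| ≤ r₁ + r₂ := by
    intro C L H r₁ r₂ h₁ h₂
    have h := abs_sub_le C L H
    rw [abs_sub_comm L H] at h
    linarith
  refine ⟨RIS.tendstoUniformlyOn_zero_of_abs_le htrig ?_,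
    RIS.tendstoUniformlyOn_zero_of_abs_le htrig ?_,
    RIS.tendstoUniformlyOn_zero_of_abs_le (by simpa using htrig.add htrig) ?_,
    RIS.tendstoUniformlyOn_zero_of_abs_le hcap ?_, RIS.tendstoUniformlyOn_zero_of_abs_le hcap ?_⟩
  · filter_upwards [eventually_ge_atTop 1] with N hN ρt hρ
    exact (RIS.abs_trigTerms_le hN hρ₀ hρ).1
  · filter_upwards [eventually_ge_atTop 1] with N hN ρt hρ
    exact (RIS.abs_trigTerms_le hN hρ₀ hρ).2
  · filter_upwards [eventually_ge_atTop 1] with N hN ρt hρ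
    have h := RIS.abs_trigTerms_le hN hρ₀ hρ
    rw [RIS.highSNR, ← RIS.highSNRHighN, add_assoc, add_sub_cancel_left]
    exact (abs_add_le _ _).trans (add_le_add h.1 h.2)
  · filter_upwards [eventually_ge_atTop 2] with N hN ρt hρ
    have h1 : 1 ≤ N := by omega
    exact key (((hch N).ergodicCapacity_sub_le h1 (hρ₀.trans_le hρ)).2.trans
      (RIS.rateBound_le h1 hρ₀ hρ)) (RIS.abs_highSNRHighN_sub_le hN hρ₀ hρ)
  · filter_upwards [eventually_ge_atTop 2] with N hN ρt hρ
    have h1 : 1 ≤ N := by omega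
    exact key ((RIS.densityCapacity_sub_le h1 (hρ₀.trans_le hρ)).2.trans
      (RIS.rateBound_le h1 hρ₀ hρ)) (RIS.abs_highSNRHighN_sub_le hN hρ₀ hρ)
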